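/- **Setting.** Let $V$ be a finite-dimensional real vector space with a fixed basis indexed by a finite set $B$. Let $\mathcal H_{\mathrm{CK}}$ be the Connes–Kreimer Hopf algebra: the commutative algebra with basis the (non-planar) rooted forests with vertices labelled by $B$, product the disjoint union, and coproduct $\Delta$ the algebra morphism with $\Delta B_+^a=B_+^a\otimes 1+(\mathrm{id}\otimes B_+^a)\Delta$, where $B_+^a$ joins the roots of a forest to a new root labelled $a$. Write $|f|$ for the number of vertices, $\widetilde\Delta f=f'\otimes f''$ for the reduced coproduct, and $\mathcal P=\{p:\Delta p=p\otimes1+1\otimes p\}$. For forests $f,g$ with $g\neq 1$, let $f\top g$ be $|g|^{-1}$ times the sum over the vertices $v$ of $g$ of the forests obtained by joining all roots of $f$ to $v$ (extended bilinearly). Let $\pi:\mathcal H_{\mathrm{CK}}\to\mathcal P$ be the projection given by $\pi(1)=0$, $\pi(f)=f-f'\top\pi(f'')$. Let $\mathcal H_{\mathrm{GL}}$ be the graded dual of $\mathcal H_{\mathrm{CK}}$, with product $\star$ dual to $\Delta$, i.e. $\langle f,x\star y\rangle=\langle f_{(1)},x\rangle\langle f_{(2)},y\rangle$; let $\mathcal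 H_{\mathrm{GL}}^{n}$ (resp. $\mathcal H_{\mathrm{GL}}^{(n)}$) be the part of weight at most (resp. equal to) $n$, products being truncated. Let $\mathcal Q=\pi^*(\mathcal H_{\mathrm{GL}})$, identified with the graded dual of $\mathcal P$, and let $\mathcal Q^{n}$ be its part of weight at most $n$. Let $\rho\ge1$, $N=\lfloor\rho\rfloor$, $T\ge0$, and let $\omega$ be a control on $[0,T]$ (continuous, non-negative and super-additive on $\{0\le s\le t\le T\}$, zero on the diagonal). For functions on $\{0\le s\le t\le T\}$ with values in a finite-dimensional space, $A\approx_m B$ means $A_{s,t}-B_{s,t}=O(\omega(s,t)^{m/\rho})$, and $\approx$ means $\approx_{N+1}$. A $\rho$-branched rough path is a map $(s,t)\mapsto\mathbf X_{s,t}\in\mathcal H_{\mathrm{GL}}^{N}$ with $\mathbf X_{s,t}=\mathbf X_{s,u}\star\mathbf X_{u,t}$ for $s\le u\le t$, $\langle 1,\mathbf X_{s,t}\rangle=1$, $\langle fg,\mathbf X_{s,t}\rangle=\langle f,\mathbf X_{s,t}\rangle\langle g,\mathbf X_{s,t}\rangle$ for $|f|+|g|\le N$, and $\langle f,\mathbf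 X_{s,t}\rangle=O(\omega(s,t)^{|f|/\rho})$ for $|f|\le N$. For a finite-dimensional space $U$, a $U$-valued $\mathbf X$-controlled path is a map $t\mapsto\mathbf H_t\in\mathcal L(\mathcal H_{\mathrm{GL}}^{N-1},U)$ on $[0,T]$ with $\mathbf H_t-\mathbf H_s=O(\omega(s,t)^{1/\rho})$ and $\langle\mathbf H_t,h\rangle\approx_{N-n}\langle\mathbf H_s,\mathbf X_{s,t}\star h\rangle$ for $0\le n\le N-1$ and $h\in\mathcal H_{\mathrm{GL}}^{(n)}$. **Proposition (rough integration of controlled paths against $X^{p\in\mathcal P}$).** Let $W$ be a finite-dimensional normed space, $\mathbf X$ a $\rho$-branched rough path, and $\mathbf H$ an $\mathbf X$-controlled path with values in $\mathcal L(\mathcal Q^{N},W)$. View $\mathbf H_s$ as an element of $\mathcal L(\mathcal H_{\mathrm{GL}}^{N-1}\otimes\mathcal Q^N,W)\subset(\mathcal H_{\mathrm{CK}}\otimes\mathcal P)\otimes W$, map it to $\mathcal H_{\mathrm{CK}}\otimes W$ by $\top\otimes\mathrm{id}$, and let $\langle\mathbf H_s,\mathbf X_{s,t}\rangle\in W$ be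 the resulting pairing. Then: 1. There is a constant $C$ such that for all $0\le s\le u\le t\le T$ $$\big\|\langle\mathbf H_s,\mathbf X_{s,t}\rangle-\langle\mathbf H_s,\mathbf X_{s,u}\rangle-\langle\mathbf H_u,\mathbf X_{u,t}\rangle\big\|\le C\,\omega(s,t)^{(N+1)/\rho}.$$ 2. For all $0\le s\le t\le T$ the limit $\int_s^t\mathbf H\,\mathrm d\mathbf X:=\lim_n\sum_{[u,v]\in\Pi_n}\langle\mathbf H_u,\mathbf X_{u,v}\rangle$ exists for every sequence $(\Pi_n)$ of partitions of $[s,t]$ with mesh tending to $0$, and does not depend on the sequence. The function $(s,t)\mapsto\int_s^t\mathbf H\,\mathrm d\mathbf X$ is additive ($\int_s^u+\int_u^t=\int_s^t$ for $s\le u\le t$), satisfies $\int_s^t\mathbf H\,\mathrm d\mathbf X\approx\langle\mathbf H_s,\mathbf X_{s,t}\rangle$, and is the unique function on $\{0\le s\le t\le T\}$ with these two properties. 3. There is exactly one path $t\mapsto\mathbf Z_t\in\mathcal L(\mathcal H_{\mathrm{GL}}^{N-1},W)$ on $[0,T]$ such that $\langle\mathbf Z_t,1\rangle=\int_0^t\mathbf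 H\,\mathrm d\mathbf X$ and $\langle\mathbf Z_t,h\star q\rangle=\langle\mathbf H_t,h\rangle(q)$ for all $h\in\mathcal H_{\mathrm{GL}}^{m}$ and $q\in\mathcal Q^{n}$ with $m+n\le N-1$; and $\mathbf Z$ is a $W$-valued $\mathbf X$-controlled path. -/

import Mathlib

open scoped TensorProduct

noncomputable section

namespace BranchedRP

/-- Planar rooted forests with vertices labelled by `ι`: either the empty forest `nil`, or
`cons a F G`, the forest whose first tree has a root labelled `a` carrying the forest `F`,
followed by the forest `G`. -/
inductive PForest (ι : Type*) where
  | nil : PForest ι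
  | cons : ι → PForest ι → PForest ι → PForest ι

namespace PForest

variable {ι : Type*}

/-- Juxtaposition of planar forests. -/
def append : PForest ι → PForest ι → PForest ι
  | nil, K => K
  | cons a F G, K => cons a F (append G K)

/-- Number of vertices. -/
def weight : PForest ι → ℕ
  | nil => 0
  | cons _ F G => 1 + weight F + weight G

/-- Elementary changes of planar structure: swapping two neighbouring trees anywhere in the
forest. -/
inductive Swap : PForest ι → PForest ι → Prop
  | swap (a : ι) (F : PForest ι) (b : ι) (G H : PForest ι) :
      Swap (cons a F (cons b G H)) (cons b G (cons a F H))
  | child (a : ι) {F F' : PForest ι} (G : PForest ι) (h : Swap F F') :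
      Swap (cons a F G) (cons a F' G)
  | tail (a : ι) (F : PForest ι) {G G' : PForest ι} (h : Swap G G') :
      Swap (cons a F G) (cons a F G')

theorem append_nil (F : PForest ι) : append F nil = F := by
  induction F with
  | nil => rfl
  | cons a F G _ ih => simp [append, ih]

theorem append_assoc (F G H : PForest ι) :
    append (append F G) H = append F (append G H) := by
  induction F with
  | nil => rfl
  | cons a F G _ ih => simp [append, ih]

theorem Swap.append_left (F : PForest ι) {G G' : PForest ι} (h : Swap G G') :
    Swap (append F G) (append F G') := by
  induction F with
  | nil => exact h
  | cons a F G _ ih => exact Swap.tail _ _ ih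

theorem Swap.append_right {F F' : PForest ι} (G : PForest ι) (h : Swap F F') :
    Swap (append F G) (append F' G) := by
  induction h with
  | swap a F b G H => exact Swap.swap _ _ _ _ _
  | child a G h _ => exact Swap.child _ _ h
  | tail a F h ih => exact Swap.tail _ _ ih

theorem Swap.weight_eq {F F' : PForest ι} (h : Swap F F') : weight F = weight F' := by
  induction h with
  | swap a F b G H => simp only [weight]; omega
  | child a G h ih => simp only [weight]; omega
  | tail a F h ih => simp only [weight]; omega

end PForest

/-- Nonplanar rooted forests with vertices labelled by `ι`. -/
def Forest (ι : Type*) : Type _ := Quot (PForest.Swap (ι := ι))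

namespace Forest

variable {ι : Type*}

/-- The nonplanar forest underlying a planar one. -/
def mk (F : PForest ι) : Forest ι := Quot.mk _ F

/-- Number of vertices of a forest. -/
def weight : Forest ι → ℕ := Quot.lift PForest.weight fun _ _ h => h.weight_eq

/-- The tree `[f]_a`, obtained by joining all the roots of `f` to a new root labelled `a`. -/
def bplus (a : ι) : Forest ι → Forest ι :=
  Quot.map (fun F => PForest.cons a F PForest.nil) fun _ _ h => PForest.Swap.child a _ h

theorem mk_append_cons (G : PForest ι) (a : ι) (F K : PForest ι) :
    mk (PForest.append G (PForest.cons a F K)) = mk (PForest.cons a F (PForest.append G K)) := by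
  induction G with
  | nil => rfl
  | cons b G H _ ih =>
    have h1 : mk (PForest.cons b G (PForest.append H (PForest.cons a F K)))
        = mk (PForest.cons b G (PForest.cons a F (PForest.append H K))) :=
      congrArg (Quot.map (PForest.cons b G) (fun _ _ h => PForest.Swap.tail b G h)) ih
    exact h1.trans (Quot.sound (PForest.Swap.swap _ _ _ _ _))

theorem mk_append_comm (F G : PForest ι) :
    mk (PForest.append F G) = mk (PForest.append G F) := by
  induction F with
  | nil => rw [PForest.append_nil]; rfl
  | cons a F K _ ih =>
    rw [mk_append_cons]
    exact congrArg (Quot.map (PForest.cons a F) (fun _ _ h => PForest.Swap.tail a F h)) ih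

/-- Forests form a commutative monoid under disjoint union; `1` is the empty forest. -/
instance : CommMonoid (Forest ι) where
  mul := Quot.map₂ PForest.append (fun F _ _ h => h.append_left F) (fun _ _ G h => h.append_right G)
  one := mk PForest.nil
  mul_assoc := by
    rintro ⟨F⟩ ⟨G⟩ ⟨H⟩
    exact congrArg mk (PForest.append_assoc F G H)
  one_mul := by rintro ⟨F⟩; rfl
  mul_one := by
    rintro ⟨F⟩
    exact congrArg mk (PForest.append_nil F)
  mul_comm := by
    rintro ⟨F⟩ ⟨G⟩
    exact mk_append_comm F G

theorem mk_nil : mk (PForest.nil : PForest ι) = 1 := rfl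

theorem mk_cons (a : ι) (F G : PForest ι) :
    mk (PForest.cons a F G) = bplus a (mk F) * mk G := rfl

theorem mk_append (F G : PForest ι) : mk (PForest.append F G) = mk F * mk G := rfl

/-- There are finitely many forests of weight at most `n`, if there are finitely many labels. -/
theorem finite_weight_le [Finite ι] (n : ℕ) : {f : Forest ι | f.weight ≤ n}.Finite := by
  have key : ∀ n : ℕ, {F : PForest ι | F.weight ≤ n}.Finite := by
    intro n
    induction n with
    | zero =>
      refine (Set.finite_singleton PForest.nil).subset ?_
      rintro (_ | ⟨a, F, G⟩) h
      · rfl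
      · simp only [Set.mem_ofPred_eq, PForest.weight] at h; omega
    | succ n ih =>
      refine ((Set.finite_singleton PForest.nil).union
        (((Set.finite_univ (α := ι)).prod (ih.prod ih)).image
          fun x => PForest.cons x.1 x.2.1 x.2.2)).subset ?_
      rintro (_ | ⟨a, F, G⟩) h
      · exact Or.inl rfl
      · simp only [Set.mem_ofPred_eq, PForest.weight] at h
        refine Or.inr ⟨(a, F, G), ⟨Set.mem_univ _, ?_, ?_⟩, rfl⟩ <;>
          simp only [Set.mem_ofPred_eq] <;> omega
  refine ((key n).image mk).subset ?_
  rintro ⟨F⟩ h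
  exact ⟨F, h, rfl⟩

end Forest

/-- The (Connes-Kreimer) algebra with basis the forests labelled by `ι`. -/
abbrev CK (ι : Type*) := MonoidAlgebra ℝ (Forest ι)

namespace CK

variable {ι : Type*}

/-- A forest, as an element of `CK ι`. -/
abbrev of (f : Forest ι) : CK ι := MonoidAlgebra.single f 1

/-- The linear extension of a map defined on forests. -/
def extend {M : Type*} [AddCommGroup M] [Module ℝ M] (φ : Forest ι → M) : CK ι →ₗ[ℝ] M :=
  (MonoidAlgebra.basis (Forest ι) ℝ).constr ℝ φ

@[simp]
theorem extend_of {M : Type*} [AddCommGroup M] [Module ℝ M] (φ : Forest ι → M) (f : Forest ι) :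
    extend φ (of f) = φ f := by
  have := (MonoidAlgebra.basis (Forest ι) ℝ).constr_basis ℝ φ f
  simpa [extend, of] using this

theorem lin_ext {M : Type*} [AddCommGroup M] [Module ℝ M] {φ ψ : CK ι →ₗ[ℝ] M}
    (h : ∀ f, φ (of f) = ψ (of f)) : φ = ψ :=
  (MonoidAlgebra.basis (Forest ι) ℝ).ext fun f => by simpa using h f

/-- The operator `B₊ᵃ`. -/
def bplus (a : ι) : CK ι →ₗ[ℝ] CK ι := extend fun f => of (f.bplus a)

theorem of_mul (f g : Forest ι) : of (f * g) = of f * of g := by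
  simp [of, MonoidAlgebra.single_mul_single]

theorem of_one : of (1 : Forest ι) = 1 := rfl

/-- The counit, which reads off the coefficient of the empty forest. -/
def counit : CK ι →ₗ[ℝ] ℝ := extend fun f => if f.weight = 0 then 1 else 0

/-- The coproduct on planar forests. -/
def comulP : PForest ι → CK ι ⊗[ℝ] CK ι
  | .nil => 1
  | .cons a F G =>
      (bplus a (of (Forest.mk F)) ⊗ₜ 1 + (bplus a).lTensor (CK ι) (comulP F)) * comulP G

theorem comulP_swap {F F' : PForest ι} (h : F.Swap F') : comulP F = comulP F' := by
  induction h with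
  | swap a F b G H => simp only [comulP]; ring
  | child a G h ih => 
    have : Forest.mk _ = Forest.mk _ := Quot.sound h
    simp only [comulP, ih, this]
  | tail a F h ih => simp only [comulP, ih]

/-- The coproduct on forests. -/
def comulF : Forest ι → CK ι ⊗[ℝ] CK ι := Quot.lift comulP fun _ _ h => comulP_swap h

theorem comulP_append (F G : PForest ι) : comulP (F.append G) = comulP F * comulP G := by
  induction F with
  | nil => simp [PForest.append, comulP]
  | cons a F K _ ih => simp only [PForest.append, comulP, ih, mul_assoc]

/-- The Connes-Kreimer coproduct `Δ`: the algebra morphism such that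
`Δ ∘ B₊ᵃ = B₊ᵃ ⊗ 1 + (id ⊗ B₊ᵃ) ∘ Δ`. -/
def comul : CK ι →ₐ[ℝ] CK ι ⊗[ℝ] CK ι :=
  MonoidAlgebra.lift ℝ _ _
    { toFun := comulF
      map_one' := rfl
      map_mul' := by
        rintro ⟨F⟩ ⟨G⟩
        exact comulP_append F G }

/-- Primitive elements. -/
def primitives (ι : Type*) : Submodule ℝ (CK ι) where
  carrier := {p | comul p = p ⊗ₜ 1 + 1 ⊗ₜ p}
  zero_mem' := by simp
  add_mem' := by
    intro p q hp hq
    simp only [Set.mem_ofPred_eq, map_add, TensorProduct.add_tmul, TensorProduct.tmul_add] at *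
    rw [hp, hq]; abel
  smul_mem' := by
    intro c p hp
    simp only [Set.mem_ofPred_eq, map_smul] at *
    rw [hp, smul_add, TensorProduct.smul_tmul', ← TensorProduct.tmul_smul]

/-- The sum over the vertices `v` of a planar forest of the forests obtained by grafting the
forest `f` on `v`, i.e. by joining all the roots of `f` to `v`. -/
def graftP (f : Forest ι) : PForest ι → CK ι
  | .nil => 0
  | .cons a F G =>
      of ((f * Forest.mk F).bplus a * Forest.mk G) + bplus a (graftP f F) * of (Forest.mk G)
        + of ((Forest.mk F).bplus a) * graftP f G

theorem graftP_swap (f : Forest ι) {F F' : PForest ι} (h : F.Swap F') :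
    graftP f F = graftP f F' := by
  induction h with
  | swap a F b G H =>
    simp only [graftP, Forest.mk_cons, of_mul]; ring
  | child a G h ih =>
    have : Forest.mk _ = Forest.mk _ := Quot.sound h
    simp only [graftP, ih, this]
  | tail a F h ih =>
    have : Forest.mk _ = Forest.mk _ := Quot.sound h
    simp only [graftP, ih, this]

/-- The sum, over the vertices `v` of `g`, of the forests obtained by grafting `f` on `v`. -/
def graft (f : Forest ι) : Forest ι → CK ι := Quot.lift (graftP f) fun _ _ h => graftP_swap f h

/-- The operation `⊤`: the average, over the vertices `v` of `g`, of the forests obtained by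
grafting `f` on `v`, extended bilinearly (and `0` if `g` is empty). -/
def top : CK ι →ₗ[ℝ] CK ι →ₗ[ℝ] CK ι :=
  extend fun f => extend fun g => (g.weight : ℝ)⁻¹ • graft f g

/-- The projection onto the augmentation ideal `H₊` along the empty forest. -/
def pos : CK ι →ₗ[ℝ] CK ι := extend fun f => if f.weight = 0 then 0 else of f

/-- The reduced coproduct `Δ̃`, extended by `0` to the empty forest. -/
def redComul : CK ι →ₗ[ℝ] CK ι ⊗[ℝ] CK ι := TensorProduct.map pos pos ∘ₗ comul.toLinearMap

/-- Iterates of `π(f) = f - f' ⊤ π(f'')`; the `n`-th one is correct up to weight `n`. -/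
def piAux : ℕ → CK ι →ₗ[ℝ] CK ι
  | 0 => 0
  | n + 1 => pos - TensorProduct.lift top ∘ₗ (piAux n).lTensor (CK ι) ∘ₗ redComul

/-- The map `π`, given by the recursion `π(1) = 0` and `π(f) = f - f' ⊤ π(f'')` in terms of
`Δ̃ f = f' ⊗ f''`. -/
def piLin : CK ι →ₗ[ℝ] CK ι := extend fun f => piAux f.weight (of f)

theorem _root_.BranchedRP.Forest.ind {P : Forest ι → Prop} (one : P 1)
    (step : ∀ a f g, P f → P g → P (f.bplus a * g)) (f : Forest ι) : P f := by
  obtain ⟨F⟩ := f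
  induction F with
  | nil => exact one
  | cons a F G hF hG => exact step a _ _ hF hG

theorem weight_one : (1 : Forest ι).weight = 0 := rfl

theorem weight_bplus (a : ι) (f : Forest ι) : (f.bplus a).weight = f.weight + 1 := by
  obtain ⟨F⟩ := f
  change 1 + F.weight + 0 = F.weight + 1
  omega

theorem weight_mul (f g : Forest ι) : (f * g).weight = f.weight + g.weight := by
  obtain ⟨F⟩ := f
  obtain ⟨G⟩ := g
  change (F.append G).weight = F.weight + G.weight
  induction F with
  | nil => simp [PForest.append, PForest.weight]
  | cons a F K _ ih => simp only [PForest.append, PForest.weight, ih]; omega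

theorem eq_one_of_weight {f : Forest ι} (h : f.weight = 0) : f = 1 := by
  induction f using Forest.ind with
  | one => rfl
  | step a f g _ _ => rw [weight_mul, weight_bplus] at h; omega

theorem bplus_of (a : ι) (f : Forest ι) : bplus a (of f) = of (f.bplus a) := by simp [bplus]

theorem comul_of (f : Forest ι) : comul (of f) = comulF f := by
  simp only [comul, of, MonoidAlgebra.lift_single, one_smul]
  rfl

theorem comul_bplus (a : ι) (x : CK ι) :
    comul (bplus a x) = bplus a x ⊗ₜ 1 + (bplus a).lTensor (CK ι) (comul x) := by
  have : comul.toLinearMap ∘ₗ bplus a = (TensorProduct.mk ℝ (CK ι) (CK ι)).flip 1 ∘ₗ bplus a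
      + (bplus a).lTensor (CK ι) ∘ₗ comul.toLinearMap := by
    refine lin_ext ?_
    intro f
    simp only [LinearMap.comp_apply, LinearMap.add_apply, AlgHom.toLinearMap_apply, bplus_of,
      comul_of]
    obtain ⟨F⟩ := f
    change comulP (PForest.cons a F PForest.nil) = _
    simp only [comulP, mul_one, bplus_of]
    rfl
  exact congrArg (fun φ => φ x) this

/-- `graft`, extended bilinearly. -/
def gr : CK ι →ₗ[ℝ] CK ι →ₗ[ℝ] CK ι := extend fun f => extend (graft f)

theorem gr_of (f g : Forest ι) : gr (of f) (of g) = graft f g := by simp [gr]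

theorem gr_one (x : CK ι) : gr x 1 = 0 := by
  have : gr.flip (1 : CK ι) = 0 := lin_ext fun f => by
    rw [LinearMap.flip_apply, ← of_one, gr_of]; rfl
  exact congrArg (fun φ => φ x) this

theorem graft_step (f : Forest ι) (a : ι) (k g : Forest ι) :
    graft f (k.bplus a * g) = of ((f * k).bplus a * g) + bplus a (graft f k) * of g
      + of (k.bplus a) * graft f g := by
  obtain ⟨K⟩ := k
  obtain ⟨G⟩ := g
  rfl

theorem gr_bplus (x : CK ι) (a : ι) (y : CK ι) :
    gr x (bplus a y) = bplus a (x * y) + bplus a (gr x y) := by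
  have : gr.compl₂ (bplus a) = (LinearMap.mul ℝ (CK ι)).compr₂ (bplus a)
      + gr.compr₂ (bplus (ι := ι) a) := by
    refine lin_ext fun f => lin_ext fun k => ?_
    have h := graft_step f a k 1
    have h2 : graft f 1 = 0 := rfl
    rw [mul_one, mul_one, of_one, mul_one, h2, mul_zero, add_zero] at h
    simp only [LinearMap.compl₂_apply, LinearMap.add_apply, LinearMap.compr₂_apply,
      LinearMap.mul_apply', bplus_of, gr_of, ← of_mul, h]
  exact congrArg (fun φ => φ x y) this

theorem graft_mul (f g h : Forest ι) :
    graft f (g * h) = graft f g * of h + of g * graft f h := by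
  induction g using Forest.ind with
  | one => 
    have h2 : graft f 1 = 0 := rfl
    rw [one_mul, h2, of_one]; simp
  | step a k g _ ih =>
    rw [mul_assoc, graft_step, graft_step, ih]
    simp only [of_mul]
    ring

theorem gr_mul (x y z : CK ι) : gr x (y * z) = gr x y * z + y * gr x z := by
  induction x using MonoidAlgebra.induction_linear with
  | zero => simp
  | add x x' hx hx' => simp only [map_add, LinearMap.add_apply, hx, hx']; ring
  | single f c =>
    have hf : MonoidAlgebra.single f c = c • of f := by simp [of]
    rw [hf]
    simp only [map_smul, LinearMap.smul_apply, smul_mul_assoc, mul_smul_comm, ← smul_add]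
    congr 1
    induction y using MonoidAlgebra.induction_linear with
    | zero => simp
    | add x x' hx hx' => simp only [map_add, add_mul, hx, hx']; ring
    | single g c =>
      have hf : MonoidAlgebra.single g c = c • of g := by simp [of]
      rw [hf]
      simp only [map_smul, smul_mul_assoc, ← smul_add]
      congr 1
      induction z using MonoidAlgebra.induction_linear with
      | zero => simp
      | add x x' hx hx' => simp only [map_add, mul_add, hx, hx']; ring
      | single h c =>
        have hf : MonoidAlgebra.single h c = c • of h := by simp [of]
        rw [hf]
        simp only [map_smul, mul_smul_comm, ← smul_add]
        congr 1
        rw [← of_mul, gr_of, gr_of, gr_of, graft_mul]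

/-- `(x₁ ⊗ x₂, y₁ ⊗ y₂) ↦ x₁ y₁ ⊗ gr x₂ y₂` -/
def psi : CK ι ⊗[ℝ] CK ι →ₗ[ℝ] CK ι ⊗[ℝ] CK ι →ₗ[ℝ] CK ι ⊗[ℝ] CK ι :=
  TensorProduct.map₂ (LinearMap.mul ℝ (CK ι)) gr

theorem psi_tmul (a b c d : CK ι) : psi (a ⊗ₜ b) (c ⊗ₜ d) = (a * c) ⊗ₜ gr b d := by
  simp [psi]

theorem psi_mul (X u v : CK ι ⊗[ℝ] CK ι) : psi X (u * v) = psi X u * v + u * psi X v := by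
  induction X with
  | zero => simp
  | add X Y hX hY => simp only [map_add, LinearMap.add_apply, hX, hY]; ring
  | tmul a b =>
    induction u with
    | zero => simp
    | add X Y hX hY => simp only [map_add, add_mul, hX, hY]; ring
    | tmul c d =>
      induction v with
      | zero => simp
      | add X Y hX hY => simp only [map_add, mul_add, hX, hY]; ring
      | tmul e f =>
        simp only [Algebra.TensorProduct.tmul_mul_tmul, psi_tmul, gr_mul, TensorProduct.tmul_add]
        congr 2 <;> ring

theorem rTensor_gr_mul (x : CK ι) (u v : CK ι ⊗[ℝ] CK ι) :
    (gr x).rTensor (CK ι) (u * v) = (gr x).rTensor (CK ι) u * v + u * (gr x).rTensor (CK ι) v := by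
  induction u with
  | zero => simp
  | add X Y hX hY => simp only [map_add, add_mul, hX, hY]; ring
  | tmul c d =>
    induction v with
    | zero => simp
    | add X Y hX hY => simp only [map_add, mul_add, hX, hY]; ring
    | tmul e f =>
      simp only [Algebra.TensorProduct.tmul_mul_tmul, LinearMap.rTensor_tmul, gr_mul,
        TensorProduct.add_tmul]

theorem psi_bplus (X : CK ι ⊗[ℝ] CK ι) (a : ι) (K : CK ι ⊗[ℝ] CK ι) :
    psi X ((bplus a).lTensor (CK ι) K) = (bplus a).lTensor (CK ι) (X * K)
      + (bplus a).lTensor (CK ι) (psi X K) := by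
  induction X with
  | zero => simp
  | add X Y hX hY => simp only [map_add, LinearMap.add_apply, hX, hY, add_mul]; abel
  | tmul x y =>
    induction K with
    | zero => simp
    | add X Y hX hY => simp only [map_add, hX, hY, mul_add]; abel
    | tmul c d =>
      simp only [LinearMap.lTensor_tmul, psi_tmul, gr_bplus, TensorProduct.tmul_add,
        Algebra.TensorProduct.tmul_mul_tmul]

theorem psi_one (X : CK ι ⊗[ℝ] CK ι) (y : CK ι) : psi X (y ⊗ₜ 1) = 0 := by
  induction X with
  | zero => simp
  | add X Y hX hY => simp only [map_add, LinearMap.add_apply, hX, hY, add_zero]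
  | tmul c d => simp [psi_tmul, gr_one]

theorem rTensor_lTensor (φ ψ : CK ι →ₗ[ℝ] CK ι) (K : CK ι ⊗[ℝ] CK ι) :
    φ.rTensor (CK ι) (ψ.lTensor (CK ι) K) = ψ.lTensor (CK ι) (φ.rTensor (CK ι) K) := by
  induction K with
  | zero => simp
  | add X Y hX hY => simp only [map_add, hX, hY]
  | tmul c d => simp

theorem comul_gr (x y : CK ι) :
    comul (gr x y) = (gr x).rTensor (CK ι) (comul y) + psi (comul x) (comul y) := by
  have : comul.toLinearMap ∘ₗ gr x = (gr x).rTensor (CK ι) ∘ₗ comul.toLinearMap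
      + psi (comul x) ∘ₗ comul.toLinearMap := by
    refine lin_ext fun f => ?_
    simp only [LinearMap.comp_apply, LinearMap.add_apply, AlgHom.toLinearMap_apply]
    induction f using Forest.ind with
    | one =>
      rw [of_one, gr_one, map_zero, map_one, Algebra.TensorProduct.one_def, psi_one,
        LinearMap.rTensor_tmul, gr_one, TensorProduct.zero_tmul, add_zero]
    | step a f g hf hg =>
      rw [of_mul, gr_mul, map_add, map_mul, map_mul, map_mul, hg, rTensor_gr_mul, psi_mul]
      have hB := map_mul (comul (ι := ι)) x (of f)
      have : comul (gr x (of (f.bplus a)))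
          = (gr x).rTensor (CK ι) (comul (of (f.bplus a)))
            + psi (comul x) (comul (of (f.bplus a))) := by
        rw [← bplus_of, gr_bplus, map_add, comul_bplus, comul_bplus, comul_bplus, hf, hB,
          map_add (psi _), psi_one, psi_bplus, map_add, map_add, rTensor_lTensor,
          LinearMap.rTensor_tmul, gr_bplus, TensorProduct.add_tmul]
        abel
      rw [this]; ring
  exact congrArg (fun φ => φ y) this

/-- Division by the weight. -/
def invW : CK ι →ₗ[ℝ] CK ι := extend fun f => (f.weight : ℝ)⁻¹ • of f

theorem top_eq (x y : CK ι) : top x y = gr x (invW y) := by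
  have : (top : CK ι →ₗ[ℝ] CK ι →ₗ[ℝ] CK ι) = gr.compl₂ invW :=
    lin_ext fun f => lin_ext fun g => by
      simp only [top, invW, gr, LinearMap.compl₂_apply, extend_of, map_smul]
  rw [this]; rfl

/-- The span of the tensors of total weight `n`. -/
def homT (ι : Type*) (n : ℕ) : Submodule ℝ (CK ι ⊗[ℝ] CK ι) :=
  Submodule.span ℝ {z | ∃ f g : Forest ι, f.weight + g.weight = n ∧ z = of f ⊗ₜ of g}

theorem homT_mul {m n : ℕ} {u v : CK ι ⊗[ℝ] CK ι} (hu : u ∈ homT ι m) (hv : v ∈ homT ι n) :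
    u * v ∈ homT ι (m + n) := by
  induction hu using Submodule.span_induction with
  | zero => simp
  | add x y _ _ hx hy => rw [add_mul]; exact add_mem hx hy
  | smul c x _ hx => rw [smul_mul_assoc]; exact Submodule.smul_mem _ _ hx
  | mem x hx =>
    obtain ⟨f, g, h, rfl⟩ := hx
    induction hv using Submodule.span_induction with
    | zero => simp
    | add x y _ _ hx hy => rw [mul_add]; exact add_mem hx hy
    | smul c x _ hx => rw [mul_smul_comm]; exact Submodule.smul_mem _ _ hx
    | mem x hx =>
      obtain ⟨f', g', h', rfl⟩ := hx
      refine Submodule.subset_span ⟨f * f', g * g', ?_, ?_⟩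
      · rw [weight_mul, weight_mul]; omega
      · rw [of_mul, of_mul, Algebra.TensorProduct.tmul_mul_tmul]

theorem homT_bplus (a : ι) {n : ℕ} {u : CK ι ⊗[ℝ] CK ι} (hu : u ∈ homT ι n) :
    (bplus a).lTensor (CK ι) u ∈ homT ι (n + 1) := by
  induction hu using Submodule.span_induction with
  | zero => simp
  | add x y _ _ hx hy => rw [map_add]; exact add_mem hx hy
  | smul c x _ hx => rw [map_smul]; exact Submodule.smul_mem _ _ hx
  | mem x hx =>
    obtain ⟨f, g, h, rfl⟩ := hx
    refine Submodule.subset_span ⟨f, g.bplus a, ?_, ?_⟩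
    · rw [weight_bplus]; omega
    · rw [LinearMap.lTensor_tmul, bplus_of]

theorem comul_mem_homT (f : Forest ι) : comul (of f) ∈ homT ι f.weight := by
  induction f using Forest.ind with
  | one =>
    rw [of_one, map_one]
    exact Submodule.subset_span ⟨1, 1, rfl, rfl⟩
  | step a f g hf hg =>
    rw [of_mul, map_mul, weight_mul]
    refine homT_mul ?_ hg
    rw [← bplus_of, comul_bplus, weight_bplus]
    refine add_mem (Submodule.subset_span ⟨f.bplus a, 1, ?_, ?_⟩) (homT_bplus a hf)
    · rw [weight_bplus, weight_one]
    · rw [bplus_of, of_one]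

/-- Division by the total weight. -/
def invW2 : CK ι ⊗[ℝ] CK ι →ₗ[ℝ] CK ι ⊗[ℝ] CK ι :=
  TensorProduct.lift (extend fun f => extend fun g =>
    ((f.weight + g.weight : ℕ) : ℝ)⁻¹ • (of f ⊗ₜ of g))

theorem invW2_of {n : ℕ} {u : CK ι ⊗[ℝ] CK ι} (hu : u ∈ homT ι n) :
    invW2 u = (n : ℝ)⁻¹ • u := by
  induction hu using Submodule.span_induction with
  | zero => simp
  | add x y _ _ hx hy => rw [map_add, hx, hy, smul_add]
  | smul c x _ hx => rw [map_smul, hx, smul_comm]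
  | mem x hx =>
    obtain ⟨f, g, h, rfl⟩ := hx
    simp only [invW2, TensorProduct.lift.tmul, extend_of, h]

theorem comul_invW (x : CK ι) : comul (invW x) = invW2 (comul x) := by
  have : comul.toLinearMap ∘ₗ invW = invW2 ∘ₗ (comul (ι := ι)).toLinearMap := lin_ext fun f => by
    simp only [LinearMap.comp_apply, AlgHom.toLinearMap_apply, invW2_of (comul_mem_homT f), invW,
      extend_of, map_smul]
  exact congrArg (fun φ => φ x) this

theorem invW2_left (x : CK ι) : invW2 (x ⊗ₜ 1) = invW x ⊗ₜ[ℝ] (1 : CK ι) := by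
  have : invW2 ∘ₗ (TensorProduct.mk ℝ (CK ι) (CK ι)).flip 1
      = (TensorProduct.mk ℝ (CK ι) (CK ι)).flip 1 ∘ₗ invW := lin_ext fun f => by
    simp only [LinearMap.comp_apply, LinearMap.flip_apply, TensorProduct.mk_apply, ← of_one]
    simp only [invW2, TensorProduct.lift.tmul, extend_of, invW, weight_one, add_zero,
      TensorProduct.smul_tmul']
  exact congrArg (fun φ => φ x) this

theorem invW2_right (x : CK ι) : invW2 (1 ⊗ₜ x) = (1 : CK ι) ⊗ₜ[ℝ] invW x := by
  have : invW2 ∘ₗ (TensorProduct.mk ℝ (CK ι) (CK ι)) 1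
      = (TensorProduct.mk ℝ (CK ι) (CK ι)) 1 ∘ₗ invW := lin_ext fun f => by
    simp only [LinearMap.comp_apply, TensorProduct.mk_apply, ← of_one]
    simp only [invW2, TensorProduct.lift.tmul, extend_of, invW, weight_one, zero_add,
      TensorProduct.tmul_smul]
  exact congrArg (fun φ => φ x) this

theorem comul_top (x : CK ι) {p : CK ι} (hp : p ∈ primitives ι) :
    comul (top x p) = top x p ⊗ₜ 1 + (top.flip p).lTensor (CK ι) (comul x) := by
  have hp' : comul p = p ⊗ₜ 1 + 1 ⊗ₜ p := hp
  have h : comul (invW p) = invW p ⊗ₜ 1 + 1 ⊗ₜ invW p := by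
    rw [comul_invW, hp', map_add, invW2_left, invW2_right]
  rw [top_eq, comul_gr, h, map_add, map_add, psi_one, LinearMap.rTensor_tmul,
    LinearMap.rTensor_tmul, gr_one, TensorProduct.zero_tmul, add_zero, zero_add]
  congr 1
  induction comul x with
  | zero => simp
  | add X Y hX hY => simp only [map_add, LinearMap.add_apply, hX, hY]
  | tmul a b => simp [psi_tmul, top_eq]

theorem of_zero_weight {M : Type*} [AddCommGroup M] [Module ℝ M] (φ ψ : CK ι →ₗ[ℝ] M)
    (h1 : φ 1 = ψ 1) (h : ∀ f : Forest ι, f.weight ≠ 0 → φ (of f) = ψ (of f)) : φ = ψ :=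
  lin_ext fun f => by
    by_cases hf : f.weight = 0
    · rw [eq_one_of_weight hf, of_one, h1]
    · exact h f hf

theorem pos_one : pos (1 : CK ι) = 0 := by
  rw [← of_one, pos, extend_of, weight_one, if_pos rfl]

theorem pos_of {f : Forest ι} (h : f.weight ≠ 0) : pos (of f) = of f := by
  rw [pos, extend_of, if_neg h]

theorem counit_one : counit (1 : CK ι) = 1 := by
  rw [← of_one, counit, extend_of, weight_one, if_pos rfl]

theorem counit_of {f : Forest ι} (h : f.weight ≠ 0) : counit (of f) = 0 := by
  rw [counit, extend_of, if_neg h]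

theorem pos_eq (x : CK ι) : pos x = x - counit x • 1 := by
  have : pos = LinearMap.id - (counit (ι := ι)).smulRight (1 : CK ι) := by
    refine of_zero_weight _ _ ?_ fun f h => ?_
    · simp [pos_one, counit_one]
    · simp [pos_of h, counit_of h]
  rw [this]; rfl

theorem counit_pos (x : CK ι) : counit (pos x) = 0 := by
  rw [pos_eq, map_sub, map_smul, counit_one]; simp

theorem pos_pos (x : CK ι) : pos (pos x) = pos x := by
  rw [pos_eq (pos x), counit_pos]; simp

theorem counit_bplus (a : ι) (x : CK ι) : counit (bplus a x) = 0 := by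
  have : counit ∘ₗ bplus (ι := ι) a = 0 := lin_ext fun f => by
    rw [LinearMap.comp_apply, bplus_of, counit_of (by rw [weight_bplus]; omega)]; rfl
  exact congrArg (fun φ => φ x) this

theorem counit_mul (x y : CK ι) : counit (x * y) = counit x * counit y := by
  have : (LinearMap.mul ℝ (CK ι)).compr₂ counit
      = (LinearMap.mul ℝ ℝ).compl₁₂ (counit (ι := ι)) counit := by
    refine lin_ext fun f => lin_ext fun g => ?_
    simp only [LinearMap.compr₂_apply, LinearMap.mul_apply', LinearMap.compl₁₂_apply, ← of_mul,
      counit, extend_of, weight_mul]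
    by_cases hf : f.weight = 0 <;> by_cases hg : g.weight = 0 <;> simp [hf, hg]
  exact congrArg (fun φ => φ x y) this

/-- `id ⊗ ε`. -/
def idCounit : CK ι ⊗[ℝ] CK ι →ₗ[ℝ] CK ι :=
  TensorProduct.lift ((LinearMap.lsmul ℝ (CK ι)).flip.compl₂ counit)

theorem idCounit_tmul (x y : CK ι) : idCounit (x ⊗ₜ y) = counit y • x := rfl

/-- `ε ⊗ id`. -/
def counitId : CK ι ⊗[ℝ] CK ι →ₗ[ℝ] CK ι :=
  TensorProduct.lift ((LinearMap.lsmul ℝ (CK ι)) ∘ₗ counit)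

theorem counitId_tmul (x y : CK ι) : counitId (x ⊗ₜ y) = counit x • y := rfl

theorem idCounit_mul (u v : CK ι ⊗[ℝ] CK ι) : idCounit (u * v) = idCounit u * idCounit v := by
  induction u with
  | zero => simp
  | add X Y hX hY => simp only [map_add, add_mul, hX, hY]
  | tmul c d =>
    induction v with
    | zero => simp
    | add X Y hX hY => simp only [map_add, mul_add, hX, hY]
    | tmul e f =>
      simp only [Algebra.TensorProduct.tmul_mul_tmul, idCounit_tmul, counit_mul,
        smul_mul_smul_comm]

theorem counitId_mul (u v : CK ι ⊗[ℝ] CK ι) : counitId (u * v) = counitId u * counitId v := by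
  induction u with
  | zero => simp
  | add X Y hX hY => simp only [map_add, add_mul, hX, hY]
  | tmul c d =>
    induction v with
    | zero => simp
    | add X Y hX hY => simp only [map_add, mul_add, hX, hY]
    | tmul e f =>
      simp only [Algebra.TensorProduct.tmul_mul_tmul, counitId_tmul, counit_mul,
        smul_mul_smul_comm]

theorem idCounit_comul (x : CK ι) : idCounit (comul x) = x := by
  have : idCounit ∘ₗ comul.toLinearMap = LinearMap.id (R := ℝ) (M := CK ι) := lin_ext fun f => by
    simp only [LinearMap.comp_apply, AlgHom.toLinearMap_apply, LinearMap.id_apply]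
    induction f using Forest.ind with
    | one => rw [of_one, map_one, Algebra.TensorProduct.one_def, idCounit_tmul, counit_one, one_smul]
    | step a f g _ hg =>
      rw [of_mul, map_mul, idCounit_mul, hg, ← bplus_of, comul_bplus, map_add, idCounit_tmul,
        counit_one, one_smul]
      have : ∀ K : CK ι ⊗[ℝ] CK ι, idCounit ((bplus a).lTensor (CK ι) K) = 0 := fun K => by
        induction K with
        | zero => simp
        | add X Y hX hY => simp only [map_add, hX, hY, add_zero]
        | tmul c d => simp [idCounit_tmul, counit_bplus]
      rw [this, add_zero]
  exact congrArg (fun φ => φ x) this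

theorem counitId_comul (x : CK ι) : counitId (comul x) = x := by
  have : counitId ∘ₗ comul.toLinearMap = LinearMap.id (R := ℝ) (M := CK ι) := lin_ext fun f => by
    simp only [LinearMap.comp_apply, AlgHom.toLinearMap_apply, LinearMap.id_apply]
    induction f using Forest.ind with
    | one => rw [of_one, map_one, Algebra.TensorProduct.one_def, counitId_tmul, counit_one, one_smul]
    | step a f g hf hg =>
      rw [of_mul, map_mul, counitId_mul, hg, ← bplus_of, comul_bplus, map_add, counitId_tmul,
        counit_bplus, zero_smul, zero_add]
      have : ∀ K : CK ι ⊗[ℝ] CK ι,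
          counitId ((bplus a).lTensor (CK ι) K) = bplus a (counitId K) := fun K => by
        induction K with
        | zero => simp
        | add X Y hX hY => simp only [map_add, hX, hY]
        | tmul c d => simp [counitId_tmul]
      rw [this, hf]
  exact congrArg (fun φ => φ x) this

theorem map_pos_eq (u : CK ι ⊗[ℝ] CK ι) : TensorProduct.map pos pos u
    = u - idCounit u ⊗ₜ 1 - 1 ⊗ₜ counitId u + counit (idCounit u) • (1 ⊗ₜ 1) := by
  induction u with
  | zero => simp
  | add X Y hX hY =>
    simp only [map_add, hX, hY, TensorProduct.add_tmul, TensorProduct.tmul_add, add_smul]; abel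
  | tmul x y =>
    simp only [TensorProduct.map_tmul, pos_eq, idCounit_tmul, counitId_tmul, map_smul,
      TensorProduct.sub_tmul, TensorProduct.tmul_sub, TensorProduct.tmul_smul, smul_eq_mul,
      ← TensorProduct.smul_tmul']
    module

theorem redComul_apply (x : CK ι) : redComul x = TensorProduct.map pos pos (comul x) := rfl

/-- `Δ x = x ⊗ 1 + 1 ⊗ x + Δ̃ x` on the augmentation ideal. -/
theorem comul_eq {x : CK ι} (hx : counit x = 0) :
    comul x = x ⊗ₜ 1 + 1 ⊗ₜ x + redComul x := by
  rw [redComul_apply, map_pos_eq, idCounit_comul, counitId_comul, hx, zero_smul, add_zero]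
  abel

theorem mem_primitives {x : CK ι} (hx : counit x = 0) (h : redComul x = 0) : x ∈ primitives ι := by
  have := comul_eq hx
  rw [h, add_zero] at this
  exact this

theorem redComul_one : redComul (1 : CK ι) = 0 := by
  rw [redComul_apply, map_one, Algebra.TensorProduct.one_def, TensorProduct.map_tmul, pos_one]; simp

theorem redComul_pos (x : CK ι) : redComul (pos x) = redComul x := by
  rw [pos_eq, map_sub, map_smul, redComul_one]; simp

theorem gr_counit (x y : CK ι) : counit (gr x y) = 0 := by
  have : gr.compr₂ counit = (0 : CK ι →ₗ[ℝ] CK ι →ₗ[ℝ] ℝ) := by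
    refine lin_ext fun f => lin_ext fun g => ?_
    simp only [LinearMap.compr₂_apply, LinearMap.zero_apply]
    induction g using Forest.ind with
    | one => rw [of_one, gr_one, map_zero]
    | step a k g _ hg =>
      rw [of_mul, gr_mul, map_add, counit_mul, counit_mul, hg, ← bplus_of, gr_bplus, map_add,
        counit_bplus, counit_bplus]; simp
  exact congrArg (fun φ => φ x y) this

theorem counit_top (x y : CK ι) : counit (top x y) = 0 := by rw [top_eq, gr_counit]

theorem gr_one_left (f : Forest ι) : gr 1 (of f) = (f.weight : ℝ) • of f := by
  induction f using Forest.ind with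
  | one => rw [of_one, gr_one, weight_one]; simp
  | step a k g hk hg =>
    rw [of_mul, gr_mul, hg, ← bplus_of, gr_bplus, hk, one_mul, weight_mul, weight_bplus, map_smul,
      mul_smul_comm]
    push_cast
    rw [add_smul, add_smul, one_smul, add_mul, smul_mul_assoc]
    abel

theorem top_one (y : CK ι) : top 1 y = pos y := by
  have : top (1 : CK ι) = pos := by
    refine of_zero_weight _ _ ?_ fun f h => ?_
    · rw [top_eq, pos_one, ← of_one, invW, extend_of, map_smul, of_one, gr_one, smul_zero]
    · rw [top_eq, pos_of h, invW, extend_of, map_smul, gr_one_left, smul_smul,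
        inv_mul_cancel₀ (by exact_mod_cast h), one_smul]
  rw [this]

/-- The cocycle property `Δ̃ (x ⊤ p) = x ⊗ p + x' ⊗ (x'' ⊤ p)`. -/
theorem redComul_top {x : CK ι} (hx : counit x = 0) {p : CK ι} (hp : p ∈ primitives ι)
    (hp0 : counit p = 0) :
    redComul (top x p) = x ⊗ₜ p + (top.flip p).lTensor (CK ι) (redComul x) := by
  have hpos : pos p = p := by rw [pos_eq, hp0]; simp
  have h := comul_eq (counit_top x p)
  rw [comul_top x hp, comul_eq hx, map_add, map_add, LinearMap.lTensor_tmul, LinearMap.lTensor_tmul,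
    LinearMap.flip_apply, LinearMap.flip_apply, top_one, hpos] at h
  have h2 := congrArg (fun z => z - top x p ⊗ₜ[ℝ] (1 : CK ι) - (1 : CK ι) ⊗ₜ[ℝ] top x p) h
  beta_reduce at h2
  calc _ = top x p ⊗ₜ[ℝ] 1 + 1 ⊗ₜ top x p + redComul (top x p) - top x p ⊗ₜ 1 - 1 ⊗ₜ top x p := by
        abel
    _ = _ := by rw [← h2]; abel

set_option synthInstance.maxHeartbeats 400000 in
set_option maxHeartbeats 1000000 in
/-- Coassociativity. -/
theorem comul_coassoc (x : CK ι) :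
    TensorProduct.assoc ℝ _ _ _ (comul.toLinearMap.rTensor (CK ι) (comul x))
      = comul.toLinearMap.lTensor (CK ι) (comul x) := by
  let A : CK ι →ₐ[ℝ] CK ι ⊗[ℝ] (CK ι ⊗[ℝ] CK ι) :=
    (Algebra.TensorProduct.assoc ℝ ℝ ℝ (CK ι) (CK ι) (CK ι)).toAlgHom.comp
      ((Algebra.TensorProduct.map comul (AlgHom.id ℝ (CK ι))).comp comul)
  let B : CK ι →ₐ[ℝ] CK ι ⊗[ℝ] (CK ι ⊗[ℝ] CK ι) :=
    (Algebra.TensorProduct.map (AlgHom.id ℝ (CK ι)) comul).comp comul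
  have hA : ∀ y, A y = TensorProduct.assoc ℝ _ _ _ (comul.toLinearMap.rTensor (CK ι) (comul y)) :=
    fun y => rfl
  have hB : ∀ y, B y = comul.toLinearMap.lTensor (CK ι) (comul y) := fun y => rfl
  have : A.toLinearMap = B.toLinearMap := lin_ext fun f => by
    simp only [AlgHom.toLinearMap_apply]
    induction f using Forest.ind with
    | one =>
      rw [of_one, hA, hB, map_one, Algebra.TensorProduct.one_def, LinearMap.rTensor_tmul,
        LinearMap.lTensor_tmul, AlgHom.toLinearMap_apply, map_one, Algebra.TensorProduct.one_def,
        TensorProduct.assoc_tmul]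
    | step a f g hf hg =>
      rw [of_mul, map_mul, map_mul, hg, ← bplus_of]
      congr 1
      rw [hA, hB] at hf ⊢
      have h1 : ∀ K : CK ι ⊗[ℝ] CK ι, TensorProduct.assoc ℝ _ _ _ (comul.toLinearMap.rTensor (CK ι)
          ((bplus a).lTensor (CK ι) K)) = ((bplus a).lTensor (CK ι)).lTensor (CK ι)
            (TensorProduct.assoc ℝ _ _ _ (comul.toLinearMap.rTensor (CK ι) K)) := fun K => by
        induction K with
        | zero => simp
        | add X Y hX hY => simp only [map_add, hX, hY]
        | tmul c d =>
          simp only [LinearMap.lTensor_tmul, LinearMap.rTensor_tmul, AlgHom.toLinearMap_apply]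
          induction comul c with
          | zero => simp
          | add X Y hX hY => simp only [TensorProduct.add_tmul, map_add, hX, hY]
          | tmul e f => simp
      have h2 : ∀ K : CK ι ⊗[ℝ] CK ι, comul.toLinearMap.lTensor (CK ι) ((bplus a).lTensor (CK ι) K)
          = TensorProduct.assoc ℝ _ _ _ ((bplus a).lTensor (CK ι) K ⊗ₜ 1)
            + ((bplus a).lTensor (CK ι)).lTensor (CK ι)
              (comul.toLinearMap.lTensor (CK ι) K) := fun K => by
        induction K with
        | zero => simp
        | add X Y hX hY => simp only [map_add, hX, hY, TensorProduct.add_tmul]; abel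
        | tmul c d =>
          simp only [LinearMap.lTensor_tmul, AlgHom.toLinearMap_apply, comul_bplus,
            TensorProduct.tmul_add, TensorProduct.assoc_tmul]
      rw [comul_bplus, map_add, map_add, map_add, h1, h2, hf, LinearMap.rTensor_tmul,
        AlgHom.toLinearMap_apply, comul_bplus, TensorProduct.add_tmul, map_add,
        TensorProduct.assoc_tmul, LinearMap.lTensor_tmul, AlgHom.toLinearMap_apply, map_one,
        Algebra.TensorProduct.one_def]
      abel
  exact congrArg (fun φ => φ x) this

set_option synthInstance.maxHeartbeats 400000 in
set_option maxHeartbeats 1000000 in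
/-- Coassociativity of the reduced coproduct. -/
theorem redComul_coassoc (x : CK ι) :
    TensorProduct.assoc ℝ _ _ _ (redComul.rTensor (CK ι) (redComul x))
      = redComul.lTensor (CK ι) (redComul x) := by
  have h1 : ∀ K : CK ι ⊗[ℝ] CK ι,
      TensorProduct.assoc ℝ _ _ _ (redComul.rTensor (CK ι) (TensorProduct.map pos pos K))
      = TensorProduct.map pos (TensorProduct.map pos pos)
          (TensorProduct.assoc ℝ _ _ _ (comul.toLinearMap.rTensor (CK ι) K)) := fun K => by
    induction K with
    | zero => simp
    | add X Y hX hY => simp only [map_add, hX, hY]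
    | tmul c d =>
      simp only [TensorProduct.map_tmul, LinearMap.rTensor_tmul, redComul_pos,
        AlgHom.toLinearMap_apply]
      rw [redComul_apply]
      induction comul c with
      | zero => simp
      | add X Y hX hY => simp only [TensorProduct.add_tmul, map_add, hX, hY]
      | tmul e f => simp
  have h2 : ∀ K : CK ι ⊗[ℝ] CK ι,
      redComul.lTensor (CK ι) (TensorProduct.map pos pos K)
      = TensorProduct.map pos (TensorProduct.map pos pos)
          (comul.toLinearMap.lTensor (CK ι) K) := fun K => by
    induction K with
    | zero => simp
    | add X Y hX hY => simp only [map_add, hX, hY]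
    | tmul c d =>
      simp only [TensorProduct.map_tmul, LinearMap.lTensor_tmul, redComul_pos,
        AlgHom.toLinearMap_apply]
      rw [redComul_apply]
  rw [redComul_apply x, h1, h2, comul_coassoc]

/-- The span of the tensors of forests `g ⊗ h` with `g` nonempty and `|h| < n`. -/
def lowT (ι : Type*) (n : ℕ) : Submodule ℝ (CK ι ⊗[ℝ] CK ι) :=
  Submodule.span ℝ {z | ∃ g h : Forest ι, g.weight ≠ 0 ∧ h.weight < n ∧ z = of g ⊗ₜ of h}

theorem redComul_mem_lowT (f : Forest ι) : redComul (of f) ∈ lowT ι f.weight := by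
  rw [redComul_apply]
  have hmem := comul_mem_homT f
  generalize comul (of f) = u at hmem
  induction hmem using Submodule.span_induction with
  | zero => simp
  | add x y _ _ hx hy => rw [map_add]; exact add_mem hx hy
  | smul c x _ hx => rw [map_smul]; exact Submodule.smul_mem _ _ hx
  | mem x hx =>
    obtain ⟨g, h, hgh, rfl⟩ := hx
    rw [TensorProduct.map_tmul]
    by_cases hg : g.weight = 0
    · rw [eq_one_of_weight hg, of_one, pos_one, TensorProduct.zero_tmul]; exact zero_mem _
    by_cases hh : h.weight = 0
    · rw [eq_one_of_weight hh, of_one, pos_one, TensorProduct.tmul_zero]; exact zero_mem _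
    rw [pos_of hg, pos_of hh]
    exact Submodule.subset_span ⟨g, h, hg, by omega, rfl⟩

theorem lTensor_congr_lowT {φ ψ : CK ι →ₗ[ℝ] CK ι} {n : ℕ}
    (h : ∀ f : Forest ι, f.weight < n → φ (of f) = ψ (of f)) {u : CK ι ⊗[ℝ] CK ι}
    (hu : u ∈ lowT ι n) : φ.lTensor (CK ι) u = ψ.lTensor (CK ι) u := by
  induction hu using Submodule.span_induction with
  | zero => simp
  | add x y _ _ hx hy => rw [map_add, map_add, hx, hy]
  | smul c x _ hx => rw [map_smul, map_smul, hx]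
  | mem x hx =>
    obtain ⟨g, k, _, hk, rfl⟩ := hx
    rw [LinearMap.lTensor_tmul, LinearMap.lTensor_tmul, h k hk]

theorem piLin_of (f : Forest ι) : piLin (of f) = piAux f.weight (of f) := by rw [piLin, extend_of]

theorem piAux_of (n : ℕ) : ∀ f : Forest ι, f.weight ≤ n → piAux n (of f) = piLin (of f) := by
  induction n using Nat.strong_induction_on with
  | _ n ih =>
    intro f hf
    rcases hf.lt_or_eq with hlt | heq
    · rw [piLin_of]
      obtain ⟨m, rfl⟩ : ∃ m, n = m + 1 := ⟨n - 1, by omega⟩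
      rcases Nat.eq_zero_or_pos f.weight with h0 | h0
      · rw [h0, eq_one_of_weight h0, of_one, piAux, piAux]
        simp only [LinearMap.sub_apply, LinearMap.comp_apply, redComul_one, map_zero, pos_one,
          sub_zero, LinearMap.zero_apply]
      · obtain ⟨k, hk⟩ : ∃ k, f.weight = k + 1 := ⟨f.weight - 1, by omega⟩
        rw [hk, piAux, piAux]
        simp only [LinearMap.sub_apply, LinearMap.comp_apply]
        congr 2
        refine lTensor_congr_lowT (fun g hg => ?_) (redComul_mem_lowT f)
        rw [ih m (by omega) g (by omega), ih k (by omega) g (by omega)]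
    · rw [piLin_of, heq]

/-- The recursion `π(x) = x - x' ⊤ π(x'')` on the augmentation ideal. -/
theorem piLin_eq (x : CK ι) :
    piLin x = pos x - TensorProduct.lift top (piLin.lTensor (CK ι) (redComul x)) := by
  have : piLin (ι := ι) = pos - TensorProduct.lift top ∘ₗ piLin.lTensor (CK ι) ∘ₗ redComul := by
    refine lin_ext fun f => ?_
    simp only [LinearMap.sub_apply, LinearMap.comp_apply]
    rw [← piAux_of (f.weight + 1) f (by omega), piAux]
    simp only [LinearMap.sub_apply, LinearMap.comp_apply]
    congr 2
    exact lTensor_congr_lowT (fun g hg => piAux_of _ g hg.le) (redComul_mem_lowT f)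
  exact congrArg (fun φ => φ x) this

theorem counit_piLin (x : CK ι) : counit (piLin x) = 0 := by
  rw [piLin_eq, map_sub, counit_pos]
  have : ∀ u : CK ι ⊗[ℝ] CK ι, counit (TensorProduct.lift top u) = 0 := fun u => by
    induction u with
    | zero => simp
    | add X Y hX hY => simp only [map_add, hX, hY, add_zero]
    | tmul c d => rw [TensorProduct.lift.tmul, counit_top]
  rw [this, sub_zero]

set_option synthInstance.maxHeartbeats 400000 in
set_option maxHeartbeats 1000000 in
theorem redComul_lift_top {n : ℕ}
    (hn : ∀ f : Forest ι, f.weight < n → piLin (of f) ∈ primitives ι) {u : CK ι ⊗[ℝ] CK ι}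
    (hu : u ∈ lowT ι n) :
    redComul (TensorProduct.lift top (piLin.lTensor (CK ι) u)) = piLin.lTensor (CK ι) u
      + (TensorProduct.lift top ∘ₗ piLin.lTensor (CK ι)).lTensor (CK ι)
        (TensorProduct.assoc ℝ _ _ _ (redComul.rTensor (CK ι) u)) := by
  induction hu using Submodule.span_induction with
  | zero => simp
  | add x y _ _ hx hy => simp only [map_add, hx, hy]; abel
  | smul c x _ hx => simp only [map_smul, hx, smul_add]
  | mem x hx =>
    obtain ⟨g, k, hg, hk, rfl⟩ := hx
    rw [LinearMap.lTensor_tmul, TensorProduct.lift.tmul,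
      redComul_top (counit_of hg) (hn k hk) (counit_piLin _), LinearMap.rTensor_tmul]
    congr 1
    induction redComul (of g) with
    | zero => simp
    | add X Y hX hY => simp only [map_add, hX, hY, TensorProduct.add_tmul]
    | tmul c d => simp

theorem piLin_of_mem (n : ℕ) : ∀ f : Forest ι, f.weight < n → piLin (of f) ∈ primitives ι := by
  induction n with
  | zero => intro f hf; omega
  | succ n ih =>
    intro f hf
    refine mem_primitives (counit_piLin _) ?_
    have hlow : redComul (of f) ∈ lowT ι n :=
      Submodule.span_mono (by rintro z ⟨g, h, hg, hh, rfl⟩; exact ⟨g, h, hg, by omega, rfl⟩)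
        (redComul_mem_lowT f)
    rw [piLin_eq, map_sub, redComul_pos, redComul_lift_top ih hlow, redComul_coassoc,
      ← LinearMap.comp_apply (LinearMap.lTensor _ _) (LinearMap.lTensor _ _),
      ← LinearMap.lTensor_comp, ← LinearMap.add_apply, ← LinearMap.lTensor_add]
    have : piLin + (TensorProduct.lift top ∘ₗ piLin.lTensor (CK ι)) ∘ₗ redComul = pos (ι := ι) :=
      LinearMap.ext fun x => by
        simp only [LinearMap.add_apply, LinearMap.comp_apply]
        rw [piLin_eq x, sub_add_cancel]
    rw [this, sub_eq_zero, redComul_apply]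
    induction comul (of f) with
    | zero => simp
    | add X Y hX hY => rw [map_add, map_add, ← hX, ← hY]
    | tmul c d => rw [TensorProduct.map_tmul, LinearMap.lTensor_tmul, pos_pos]

theorem piLin_mem (x : CK ι) : piLin x ∈ primitives ι := by
  induction x using MonoidAlgebra.induction_linear with
  | zero => rw [map_zero]; exact zero_mem _
  | add x y hx hy => rw [map_add]; exact add_mem hx hy
  | single f c =>
    have hf : MonoidAlgebra.single f c = c • of f := by simp [of]
    rw [hf, map_smul]
    exact Submodule.smul_mem _ _ (piLin_of_mem _ f (Nat.lt_succ_self _))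

/-- The projection `π` of `H_CK` onto its primitive elements. -/
def proj : CK ι →ₗ[ℝ] primitives ι := piLin.codRestrict _ piLin_mem

theorem proj_primitive (p : primitives ι) : proj (p : CK ι) = p := by
  have hp : comul (p : CK ι) = (p : CK ι) ⊗ₜ 1 + 1 ⊗ₜ (p : CK ι) := p.2
  have h0 : counit (p : CK ι) = 0 := by
    have h := idCounit_comul (p : CK ι)
    rw [hp, map_add, idCounit_tmul, idCounit_tmul, counit_one, one_smul] at h
    have h2 := congrArg counit (add_eq_left.mp h)
    simpa [counit_one] using h2
  have h1 : redComul (p : CK ι) = 0 := by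
    have h := comul_eq h0
    rw [hp] at h
    exact add_eq_left.mp h.symm
  refine Subtype.ext ?_
  change piLin (p : CK ι) = p
  rw [piLin_eq, h1, map_zero, map_zero, sub_zero, pos_eq, h0, zero_smul, sub_zero]

end CK

/-- The linear dual of `H_CK`, which contains `H_GL` as the functionals that vanish on all
forests of large weight. -/
abbrev CKDual (ι : Type*) := Module.Dual ℝ (CK ι)

variable {ι : Type*}

/-- `H_GL^N`: the graded dual of `H_CK`, truncated at weight `N`, i.e. the functionals on `H_CK`
that vanish on the forests of weight larger than `N`. The duality pairing is evaluation; under it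
a forest `g`, as an element of `H_GL`, is the functional that takes the number of automorphisms of
`g` as its value at `g` and vanishes at all other forests. -/
def HGL (ι : Type*) (N : ℕ) : Submodule ℝ (CKDual ι) where
  carrier := {x | ∀ f : Forest ι, N < f.weight → x (CK.of f) = 0}
  zero_mem' := fun _ _ => rfl
  add_mem' := by
    intro x y hx hy f hf
    rw [LinearMap.add_apply, hx f hf, hy f hf, add_zero]
  smul_mem' := by
    intro c x hx f hf
    rw [LinearMap.smul_apply, hx f hf, smul_zero]

/-- `H_GL^(n)`: the homogeneous elements of weight `n`. -/
def HGLHom (ι : Type*) (n : ℕ) : Submodule ℝ (CKDual ι) where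
  carrier := {x | ∀ f : Forest ι, f.weight ≠ n → x (CK.of f) = 0}
  zero_mem' := fun _ _ => rfl
  add_mem' := by
    intro x y hx hy f hf
    rw [LinearMap.add_apply, hx f hf, hy f hf, add_zero]
  smul_mem' := by
    intro c x hx f hf
    rw [LinearMap.smul_apply, hx f hf, smul_zero]

/-- Truncation at weight `N`: it keeps the values at the forests of weight at most `N` and
replaces the other ones by `0`. -/
def trunc (N : ℕ) : CKDual ι →ₗ[ℝ] HGL ι N :=
  LinearMap.codRestrict (HGL ι N)
    (LinearMap.dualMap (CK.extend fun f => if f.weight ≤ N then CK.of f else 0))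
    (by
      intro x f hf
      rw [LinearMap.dualMap_apply, CK.extend_of, if_neg (by omega), map_zero])

/-- The Grossman-Larson product `x ⋆ y`, dual to the coproduct:
`⟨f, x ⋆ y⟩ = ⟨f₍₁₎, x⟩ ⟨f₍₂₎, y⟩`. -/
def glMul (x y : CKDual ι) : CKDual ι :=
  LinearMap.mul' ℝ ℝ ∘ₗ TensorProduct.map x y ∘ₗ CK.comul.toLinearMap

/-- The linear form on `H_CK` that reads off the coefficient of the forest `f`. -/
def coord (f : Forest ι) : CKDual ι := (MonoidAlgebra.basis (Forest ι) ℝ).coord f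

theorem coord_of_self (f : Forest ι) : coord f (CK.of f) = 1 := by
  have : CK.of f = MonoidAlgebra.basis (Forest ι) ℝ f := by simp [CK.of]
  rw [this, coord, Module.Basis.coord_apply, Module.Basis.repr_self, Finsupp.single_eq_same]

theorem coord_of_ne {f g : Forest ι} (h : f ≠ g) : coord f (CK.of g) = 0 := by
  have : CK.of g = MonoidAlgebra.basis (Forest ι) ℝ g := by simp [CK.of]
  rw [this, coord, Module.Basis.coord_apply, Module.Basis.repr_self, Finsupp.single_eq_of_ne h]

/-- The unit `1` of `H_GL`, dual to the empty forest. -/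
def glOne (ι : Type*) (N : ℕ) : HGL ι N := trunc N (coord 1)

/-- The transpose `π* : H_GL → H_GL` of the projection `π` onto the primitive elements. -/
def piStar : CKDual ι →ₗ[ℝ] CKDual ι :=
  LinearMap.dualMap ((CK.primitives ι).subtype ∘ₗ CK.proj)

/-- `𝒬 = π*(H_GL)`, truncated at weight `N`. -/
def Q (ι : Type*) (N : ℕ) : Submodule ℝ (CKDual ι) := (HGL ι N).map piStar

/-- `π*` as a map from `H_GL^N` onto `𝒬^N`. -/
def piQ (N : ℕ) : HGL ι N →ₗ[ℝ] Q ι N := piStar.submoduleMap (HGL ι N)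

/-- The finite set of forests of weight at most `n`. -/
def forestsLE (ι : Type*) [Finite ι] (n : ℕ) : Finset (Forest ι) :=
  (Forest.finite_weight_le (ι := ι) n).toFinset

/-- The transpose `⊤* : H_GL^N → H_GL^(N-1) ⊗ 𝒬^N` of `⊤ : H_CK ⊗ 𝒫 → H_CK`, where `𝒬` is
identified with the dual of `𝒫` through `π*`: the functional `p ↦ ⟨f ⊤ p, x⟩` on `𝒫` is
the element `g ↦ ⟨f ⊤ π(g), x⟩` of `𝒬`. -/
def topStar [Finite ι] (N : ℕ) (x : HGL ι N) : HGL ι (N - 1) ⊗[ℝ] Q ι N :=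
  ∑ f ∈ forestsLE ι (N - 1),
    trunc (N - 1) (coord f) ⊗ₜ[ℝ]
      piQ N (trunc N ((x : CKDual ι) ∘ₗ CK.top (CK.of f)))

/-- `⊤*` is the transpose of `⊤`: pairing `⊤* x` with `g ⊗ p`, for a forest `g` and `p ∈ 𝒫` in the
range of weights that is kept, gives `⟨g ⊤ p, x⟩`. -/
theorem topStar_pairing [Finite ι] (N : ℕ) (x : HGL ι N) (g : Forest ι) (hg : g.weight ≤ N - 1)
    (p : CK.primitives ι) (hp : ∀ y : CKDual ι, (trunc N y : CKDual ι) p = y p) :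
    TensorProduct.lift ((LinearMap.mul ℝ ℝ).compl₁₂
        ((Module.Dual.eval ℝ (CK ι) (CK.of g)) ∘ₗ (HGL ι (N - 1)).subtype)
        ((Module.Dual.eval ℝ (CK ι) (p : CK ι)) ∘ₗ (Q ι N).subtype)) (topStar N x)
      = (x : CKDual ι) (CK.top (CK.of g) (p : CK ι)) := by
  have h1 : ∀ f : Forest ι, (trunc (N - 1) (coord f) : CKDual ι) (CK.of g)
      = coord f (CK.of g) := fun f => by
    change coord f (CK.extend _ (CK.of g)) = _
    rw [CK.extend_of, if_pos hg]
  have h2 : ∀ y : HGL ι N, (piQ N y : CKDual ι) (p : CK ι) = (y : CKDual ι) (p : CK ι) := fun y => by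
    change (y : CKDual ι) (CK.proj (p : CK ι) : CK ι) = _
    rw [CK.proj_primitive]
  have hmem : g ∈ forestsLE ι (N - 1) := by simpa [forestsLE] using hg
  rw [topStar, map_sum, Finset.sum_eq_single_of_mem g hmem]
  · simp only [TensorProduct.lift.tmul, LinearMap.compl₁₂_apply, LinearMap.comp_apply,
      Submodule.subtype_apply, Module.Dual.eval_apply, LinearMap.mul_apply', h1, h2, hp,
      coord_of_self, one_mul]
  · intro f _ hf
    simp only [TensorProduct.lift.tmul, LinearMap.compl₁₂_apply, LinearMap.comp_apply,
      Submodule.subtype_apply, Module.Dual.eval_apply, LinearMap.mul_apply', h1,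
      coord_of_ne hf, zero_mul]

/-- The pairing `⟨A, x⟩ ∈ W` of `A ∈ L(H_GL^(N-1), L(𝒬^N, W)) = (H_CK ⊗ 𝒫) ⊗ W` with
`x ∈ H_GL^N`, where `A` is mapped to `H_CK ⊗ W` by `⊤ ⊗ id`. -/
def topPairing [Finite ι] {W : Type*} [AddCommGroup W] [Module ℝ W] {N : ℕ}
    (A : HGL ι (N - 1) →ₗ[ℝ] Q ι N →ₗ[ℝ] W) (x : HGL ι N) : W :=
  TensorProduct.lift A (topStar N x)

/-- A control on `[0, T]`. -/
structure IsControl (T : ℝ) (ω : ℝ → ℝ → ℝ) : Prop where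
  continuousOn : ContinuousOn (Function.uncurry ω) {p : ℝ × ℝ | 0 ≤ p.1 ∧ p.1 ≤ p.2 ∧ p.2 ≤ T}
  nonneg : ∀ s t, 0 ≤ s → s ≤ t → t ≤ T → 0 ≤ ω s t
  diag : ∀ t, 0 ≤ t → t ≤ T → ω t t = 0
  superadditive : ∀ s u t, 0 ≤ s → s ≤ u → u ≤ t → t ≤ T → ω s u + ω u t ≤ ω s t

/-- A `ρ`-branched rough path on `[0, T]` controlled by `ω`, over the vector space with basis
`ι`. -/
structure IsBranchedRoughPath (ρ T : ℝ) (ω : ℝ → ℝ → ℝ) (X : ℝ → ℝ → HGL ι ⌊ρ⌋₊) : Prop where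
  chen : ∀ s u t, 0 ≤ s → s ≤ u → u ≤ t → t ≤ T →
    X s t = trunc ⌊ρ⌋₊ (glMul (X s u) (X u t))
  map_one : ∀ s t, 0 ≤ s → s ≤ t → t ≤ T → (X s t : CKDual ι) (CK.of 1) = 1
  map_mul : ∀ s t, 0 ≤ s → s ≤ t → t ≤ T → ∀ f g : Forest ι, f.weight + g.weight ≤ ⌊ρ⌋₊ →
    (X s t : CKDual ι) (CK.of (f * g))
      = (X s t : CKDual ι) (CK.of f) * (X s t : CKDual ι) (CK.of g)
  regular : ∀ f : Forest ι, f.weight ≤ ⌊ρ⌋₊ → ∃ C : ℝ, ∀ s t, 0 ≤ s → s ≤ t → t ≤ T →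
    |(X s t : CKDual ι) (CK.of f)| ≤ C * ω s t ^ ((f.weight : ℝ) / ρ)

/-- `A ≈_m B`: the difference of the two `U`-valued functions on the simplex is of order
`O(ω(s,t)^(m/ρ))`. As `U` is finite-dimensional wherever this is used, no norm is needed: it is
enough to compare all coordinates. -/
def AlmostEq {U : Type*} [AddCommGroup U] [Module ℝ U] (ρ T : ℝ) (ω : ℝ → ℝ → ℝ) (m : ℕ)
    (A B : ℝ → ℝ → U) : Prop :=
  ∀ φ : Module.Dual ℝ U, ∃ C : ℝ, ∀ s t, 0 ≤ s → s ≤ t → t ≤ T →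
    |φ (A s t - B s t)| ≤ C * ω s t ^ ((m : ℝ) / ρ)

/-- `H` is a `U`-valued `X`-controlled path on `[0, T]`. -/
structure IsControlledPath {U : Type*} [AddCommGroup U] [Module ℝ U] (ρ T : ℝ) (ω : ℝ → ℝ → ℝ)
    (X : ℝ → ℝ → HGL ι ⌊ρ⌋₊) (H : ℝ → HGL ι (⌊ρ⌋₊ - 1) →ₗ[ℝ] U) : Prop where
  regular : AlmostEq ρ T ω 1 (fun _ t => H t) (fun s _ => H s)
  controlled : ∀ n : ℕ, n < ⌊ρ⌋₊ → ∀ h : HGL ι (⌊ρ⌋₊ - 1), (h : CKDual ι) ∈ HGLHom ι n →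
    AlmostEq ρ T ω (⌊ρ⌋₊ - n) (fun _ t => H t h)
      (fun s t => H s (trunc (⌊ρ⌋₊ - 1) (glMul (X s t) h)))

/-- `s = τ 0 ≤ τ 1 ≤ ⋯ ≤ τ k = t` is a partition of `[s, t]`. -/
structure IsPartition (s t : ℝ) (k : ℕ) (τ : ℕ → ℝ) : Prop where
  left : τ 0 = s
  right : τ k = t
  mono : ∀ i < k, τ i ≤ τ (i + 1)

/-- For every sequence of partitions of `[s, t]` with vanishing mesh size, the Riemann sums of
the germ `Ξ` converge to `w`. -/
def RiemannSumsTendsto {W : Type*} [NormedAddCommGroup W] (Ξ : ℝ → ℝ → W) (s t : ℝ) (w : W) :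
    Prop :=
  ∀ (k : ℕ → ℕ) (τ : ℕ → ℕ → ℝ), (∀ n, IsPartition s t (k n) (τ n)) →
    (∀ δ > 0, ∀ᶠ n in Filter.atTop, ∀ i < k n, τ n (i + 1) - τ n i < δ) →
    Filter.Tendsto (fun n => ∑ i ∈ Finset.range (k n), Ξ (τ n i) (τ n (i + 1))) Filter.atTop
      (nhds w)

/-- Additivity on the simplex. -/
def IsAdditive {W : Type*} [AddCommGroup W] (T : ℝ) (J : ℝ → ℝ → W) : Prop :=
  ∀ s u t, 0 ≤ s → s ≤ u → u ≤ t → t ≤ T → J s u + J u t = J s t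

/-- `Z` is the path of linear maps determined by `⟨Z_t, 1⟩ = I 0 t` and
`⟨Z_t, h ⋆ q⟩ = ⟨H_{q;t}, h⟩`, for all `h ∈ H_GL` and `q ∈ 𝒬` of total weight at most `N - 1`. -/
def IsIntegralPath {W : Type*} [AddCommGroup W] [Module ℝ W] {N : ℕ} (T : ℝ)
    (H : ℝ → HGL ι (N - 1) →ₗ[ℝ] Q ι N →ₗ[ℝ] W) (I : ℝ → ℝ → W)
    (Z : ℝ → HGL ι (N - 1) →ₗ[ℝ] W) : Prop :=
  ∀ t, 0 ≤ t → t ≤ T →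
    Z t (glOne ι (N - 1)) = I 0 t ∧
    ∀ (m n : ℕ) (h : HGL ι (N - 1)) (q : Q ι N), m + n ≤ N - 1 →
      (h : CKDual ι) ∈ HGL ι m → (q : CKDual ι) ∈ HGL ι n →
        Z t (trunc (N - 1) (glMul (h : CKDual ι) (q : CKDual ι))) = H t h q

end BranchedRP

end

/-! The algebra rests on how `⊤` and `π` interact. For primitive `p`, `Δ(x ⊤ p) = (x ⊤ p) ⊗ 1 + x₍₁₎
⊗ (x₍₂₎ ⊤ p)` (`comul_top`), `π(x ⊤ p) = ε(x) p` (`piLin_top`), and `x₍₁₎ ⊤ π(x₍₂₎) = x - ε(x) 1`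
(`lift_top_comul`). Dually, `H_GL` is spanned by `1` and the products `h ⋆ q` with `q ∈ 𝒬`, and the
pairing `⟨A, ·⟩` (`topFull`) is the linear map that kills `1` and sends `h ⋆ q` to `A(h)(q)`. Write
`g*` for the dual basis vector of a forest `g` and `y_g ∈ 𝒬` for the functional `k ↦ ⟨g ⊤ π(k), y⟩`.
The cocycle identity becomes `⟨A, x ⋆ y⟩ = y(1) ⟨A, x⟩ + ∑_g A(x ⋆ g*)(y_g)` (`topFull_glMul`), and
all the estimates come from it.

Almost additivity: insert Chen's relation `X_{s,t} = X_{s,u} ⋆ X_{u,t}`. Up to the part of weight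
above `N` lost in the truncation, which is `O(ω^((N+1)/ρ))`, the defect of the germ is `∑_g
(H_s(X_{s,u} ⋆ g*) - H_u(g*))((X_{u,t})_g)`. The first factor is of order `N - |g|` because `H` is
controlled. The second is of order `|g| + 1` because grafting `g` on a nonempty forest gives weight
at least `|g| + 1`.

Integral: since `(N+1)/ρ > 1`, sewing applies. Riemann sums along a grid stay close to the germ by
the maximal inequality (`norm_sum_sub_le`); a limit along one fixed ultrafilter is additive and
close to the germ (`exists_isAdditive`). Conversely, every additive function close to the germ is
the limit of all its Riemann sums (`IsAdditive.riemannSumsTendsto`), which yields both convergence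
and uniqueness.

Integral path: the conditions force `Z_t(h) = h(1) ∫_0^t H dX + ⟨H_t, h⟩` by the decomposition of
`H_GL`. The same product formula, with `y = h`, shows that `Z` is controlled. -/

noncomputable section

namespace BranchedRP

/-! ### Controls and the sewing lemma. -/

section Sewing

variable {W : Type*} [NormedAddCommGroup W] {T θ C : ℝ} {ω : ℝ → ℝ → ℝ} {Ξ : ℝ → ℝ → W}

theorem IsControl.mono (hω : IsControl T ω) {s u v t : ℝ} (hs : 0 ≤ s) (hsu : s ≤ u) (huv : u ≤ v)
    (hvt : v ≤ t) (ht : t ≤ T) : ω u v ≤ ω s t := by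
  have h1 := hω.superadditive s u t hs hsu (huv.trans hvt) ht
  have h2 := hω.superadditive u v t (hs.trans hsu) huv hvt ht
  have h3 := hω.nonneg s u hs hsu (by linarith)
  have h4 := hω.nonneg v t (by linarith) hvt ht
  linarith

theorem IsControl.sum_le (hω : IsControl T ω) {τ : ℕ → ℝ} (hτ : Monotone τ)
    (hτT : ∀ i, 0 ≤ τ i ∧ τ i ≤ T) (n : ℕ) :
    ∑ i ∈ Finset.range n, ω (τ i) (τ (i + 1)) ≤ ω (τ 0) (τ n) := by
  induction n with
  | zero => simp [hω.diag (τ 0) (hτT 0).1 (hτT 0).2]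
  | succ n ih =>
    rw [Finset.sum_range_succ]
    have := hω.superadditive (τ 0) (τ n) (τ (n + 1)) (hτT 0).1 (hτ (Nat.zero_le _))
      (hτ (Nat.le_succ _)) (hτT _).2
    linarith

/-- The simplex is compact, so `ω` is uniformly continuous there, and it vanishes on the diagonal.
-/
theorem IsControl.exists_mesh (hω : IsControl T ω) {ε : ℝ} (hε : 0 < ε) :
    ∃ δ > 0, ∀ u v, 0 ≤ u → u ≤ v → v ≤ T → v - u < δ → ω u v < ε := by
  have hK : IsCompact {p : ℝ × ℝ | 0 ≤ p.1 ∧ p.1 ≤ p.2 ∧ p.2 ≤ T} := by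
    refine (isCompact_Icc (a := ((0 : ℝ), (0 : ℝ))) (b := (T, T))).of_isClosed_subset ?_ ?_
    · exact (isClosed_le continuous_const continuous_fst).inter
        ((isClosed_le continuous_fst continuous_snd).inter
          (isClosed_le continuous_snd continuous_const))
    · rintro ⟨a, b⟩ ⟨h1, h2, h3⟩
      exact ⟨⟨h1, h1.trans h2⟩, ⟨h2.trans h3, h3⟩⟩
  have hu := hK.uniformContinuousOn_of_continuous hω.continuousOn
  obtain ⟨δ, hδ, h⟩ := Metric.uniformContinuousOn_iff.1 hu ε hε
  refine ⟨δ, hδ, fun u v h0 huv hv hd => ?_⟩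
  have := h (u, v) ⟨h0, huv, hv⟩ (u, u) ⟨h0, le_rfl, huv.trans hv⟩ (by
    rw [Prod.dist_eq, dist_self, Real.dist_eq, abs_of_nonneg (by simpa using huv)]
    exact max_lt hδ hd)
  rw [Real.dist_eq] at this
  simp only [Function.uncurry_apply_pair, hω.diag u h0 (huv.trans hv), sub_zero] at this
  exact (le_abs_self _).trans_lt this

/-- Write `ω ^ θ = ω ^ (θ - 1) * ω`: the first factor is uniformly small on short intervals, and the
second sums to at most `ω 0 T` by superadditivity. This is where `θ > 1` makes the errors vanish
with the mesh. -/
theorem IsControl.exists_sum_rpow_le (hω : IsControl T ω) (hθ : 1 < θ) {ε : ℝ} (hε : 0 < ε) :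
    ∃ δ > 0, ∀ (k : ℕ) (τ : ℕ → ℝ), Monotone τ → (∀ i, 0 ≤ τ i ∧ τ i ≤ T) →
      (∀ i < k, τ (i + 1) - τ i < δ) →
      ∑ i ∈ Finset.range k, ω (τ i) (τ (i + 1)) ^ θ ≤ ε * ω 0 T := by
  -- The threshold is chosen so that its power `θ - 1` is exactly `ε`.
  obtain ⟨δ, hδ, h⟩ := hω.exists_mesh (Real.rpow_pos_of_pos hε (θ - 1)⁻¹)
  refine ⟨δ, hδ, fun k τ hτ hτT hm => ?_⟩
  have key : ∀ i ∈ Finset.range k, ω (τ i) (τ (i + 1)) ^ θ ≤ ε * ω (τ i) (τ (i + 1)) := by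
    intro i hi
    have h0 := hω.nonneg _ _ (hτT i).1 (hτ i.le_succ) (hτT (i + 1)).2
    have h1 := (h _ _ (hτT i).1 (hτ i.le_succ) (hτT (i + 1)).2 (hm i (Finset.mem_range.1 hi))).le
    have h2 := Real.rpow_le_rpow h0 h1 (z := θ - 1) (by linarith)
    rw [← Real.rpow_mul hε.le, inv_mul_cancel₀ (by linarith), Real.rpow_one] at h2
    calc ω (τ i) (τ (i + 1)) ^ θ
        = ω (τ i) (τ (i + 1)) ^ (θ - 1) * ω (τ i) (τ (i + 1)) := by
          conv_lhs => rw [show θ = (θ - 1) + 1 by ring]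
          rw [Real.rpow_add_of_nonneg h0 (by linarith) zero_le_one, Real.rpow_one]
      _ ≤ _ := mul_le_mul_of_nonneg_right h2 h0
  refine (Finset.sum_le_sum key).trans ?_
  rw [← Finset.mul_sum]
  exact mul_le_mul_of_nonneg_left ((hω.sum_le hτ hτT k).trans
    (hω.mono le_rfl (hτT 0).1 (hτ (Nat.zero_le _)) (hτT k).2 le_rfl)) hε.le

/-- `Ξ` is almost additive, of order `θ`. -/
def AlmostAdditive (T θ C : ℝ) (ω : ℝ → ℝ → ℝ) (Ξ : ℝ → ℝ → W) : Prop :=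
  ∀ s u t, 0 ≤ s → s ≤ u → u ≤ t → t ≤ T → ‖Ξ s t - Ξ s u - Ξ u t‖ ≤ C * ω s t ^ θ

theorem AlmostAdditive.diag (h : AlmostAdditive T θ C ω Ξ) (hω : IsControl T ω) (hθ : 1 < θ) {t : ℝ}
    (h0 : 0 ≤ t) (hT : t ≤ T) : Ξ t t = 0 := by
  have := h t t t h0 le_rfl le_rfl hT
  rw [hω.diag t h0 hT, Real.zero_rpow (by linarith), mul_zero] at this
  simpa using this

/-- The maximal inequality for Riemann sums of an almost additive germ. -/
theorem AlmostAdditive.norm_sum_sub_le (h : AlmostAdditive T θ C ω Ξ) (hω : IsControl T ω)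
    (hθ : 1 < θ) (hC : 0 ≤ C) {τ : ℕ → ℝ} (hτ : Monotone τ) (hτT : ∀ i, 0 ≤ τ i ∧ τ i ≤ T)
    (n : ℕ) : ∀ a : ℕ,
    ‖∑ i ∈ Finset.range n, Ξ (τ (a + i)) (τ (a + i + 1)) - Ξ (τ a) (τ (a + n))‖
      ≤ 2 * C / (1 - 2 ^ (1 - θ)) * ω (τ a) (τ (a + n)) ^ θ := by
  have h2 : (2 : ℝ) ^ (1 - θ) < 1 := Real.rpow_lt_one_of_one_lt_of_neg (by norm_num) (by linarith)
  set K := 2 * C / (1 - 2 ^ (1 - θ)) with hK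
  have hK0 : 0 ≤ K := div_nonneg (by linarith) (by linarith)
  -- `K` is the fixed point of the recursion: two halves cost `2 * K * (w / 2) ^ θ`, and the two
  -- splittings cost `C * w ^ θ` each.
  have hKeq : 2 ^ (1 - θ) * K + 2 * C = K := by
    have : K * (1 - 2 ^ (1 - θ)) = 2 * C := div_mul_cancel₀ _ (by linarith)
    linarith
  induction n using Nat.strong_induction_on with
  | _ n ih =>
    intro a
    rcases Nat.eq_zero_or_pos n with rfl | hn
    · simp only [Finset.range_zero, Finset.sum_empty, add_zero, zero_sub, norm_neg,
        h.diag hω hθ (hτT a).1 (hτT a).2, norm_zero, hω.diag _ (hτT a).1 (hτT a).2,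
        Real.zero_rpow (by linarith : θ ≠ 0), mul_zero, le_refl]
    · classical
      set w := ω (τ a) (τ (a + n)) with hw
      have hw0 : 0 ≤ w := hω.nonneg _ _ (hτT _).1 (hτ (by omega)) (hτT _).2
      -- Split around the cell in which the control first exceeds half its total. The part to its
      -- left has control at most `w / 2` by choice, the part to its right by superadditivity. The
      -- bound `n - 1` guarantees that this middle cell exists.
      set j := Nat.findGreatest (fun j => ω (τ a) (τ (a + j)) ≤ w / 2) (n - 1) with hj
      have hjn : j ≤ n - 1 := Nat.findGreatest_le _
      have hPj : ω (τ a) (τ (a + j)) ≤ w / 2 :=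
        Nat.findGreatest_spec (P := fun j => ω (τ a) (τ (a + j)) ≤ w / 2) (Nat.zero_le (n - 1))
          (by rw [add_zero, hω.diag _ (hτT a).1 (hτT a).2]; linarith)
      obtain ⟨m, hm⟩ : ∃ m, n = j + 1 + m := ⟨n - (j + 1), by omega⟩
      have hQ : ω (τ (a + (j + 1))) (τ (a + n)) ≤ w / 2 := by
        rcases Nat.eq_zero_or_pos m with rfl | hmpos
        · rw [hm, add_zero, hω.diag _ (hτT _).1 (hτT _).2]; linarith
        · have : ¬ ω (τ a) (τ (a + (j + 1))) ≤ w / 2 :=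
            Nat.findGreatest_is_greatest (P := fun j => ω (τ a) (τ (a + j)) ≤ w / 2)
              (n := n - 1) (k := j + 1) (by omega) (by omega)
          have := hω.superadditive (τ a) (τ (a + (j + 1))) (τ (a + n)) (hτT _).1 (hτ (by omega))
            (hτ (by omega)) (hτT _).2
          linarith
      have e1 := ih j (by omega) a
      have e2 := ih m (by omega) (a + (j + 1))
      have e3 := h (τ a) (τ (a + j)) (τ (a + n)) (hτT _).1 (hτ (by omega)) (hτ (by omega)) (hτT _).2
      have e4 := h (τ (a + j)) (τ (a + (j + 1))) (τ (a + n)) (hτT _).1 (hτ (by omega))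
        (hτ (by omega)) (hτT _).2
      rw [show a + (j + 1) + m = a + n by omega] at e2
      have hpow : ∀ x, 0 ≤ x → x ≤ w / 2 → K * x ^ θ ≤ K * (w ^ θ / 2 ^ θ) := fun x hx hxw => by
        rw [← Real.div_rpow hw0 (by norm_num)]
        exact mul_le_mul_of_nonneg_left (Real.rpow_le_rpow hx hxw (by linarith)) hK0
      have e1' := e1.trans (hpow _ (hω.nonneg _ _ (hτT _).1 (hτ (by omega)) (hτT _).2) hPj)
      have e2' := e2.trans (hpow _ (hω.nonneg _ _ (hτT _).1 (hτ (by omega)) (hτT _).2) hQ)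
      have e4' : ‖Ξ (τ (a + j)) (τ (a + n)) - Ξ (τ (a + j)) (τ (a + (j + 1)))
          - Ξ (τ (a + (j + 1))) (τ (a + n))‖ ≤ C * w ^ θ :=
        e4.trans (mul_le_mul_of_nonneg_left (Real.rpow_le_rpow
          (hω.nonneg _ _ (hτT _).1 (hτ (by omega)) (hτT _).2)
          (hω.mono (hτT _).1 (hτ (by omega)) (hτ (by omega)) le_rfl (hτT _).2) (by linarith)) hC)
      have hsum : ∑ i ∈ Finset.range n, Ξ (τ (a + i)) (τ (a + i + 1)) - Ξ (τ a) (τ (a + n))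
          = (∑ i ∈ Finset.range j, Ξ (τ (a + i)) (τ (a + i + 1)) - Ξ (τ a) (τ (a + j)))
            + (∑ i ∈ Finset.range m, Ξ (τ (a + (j + 1) + i)) (τ (a + (j + 1) + i + 1))
                - Ξ (τ (a + (j + 1))) (τ (a + n)))
            - (Ξ (τ a) (τ (a + n)) - Ξ (τ a) (τ (a + j)) - Ξ (τ (a + j)) (τ (a + n)))
            - (Ξ (τ (a + j)) (τ (a + n)) - Ξ (τ (a + j)) (τ (a + (j + 1)))
              - Ξ (τ (a + (j + 1))) (τ (a + n))) := by
        have : ∑ i ∈ Finset.range n, Ξ (τ (a + i)) (τ (a + i + 1))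
            = ∑ i ∈ Finset.range j, Ξ (τ (a + i)) (τ (a + i + 1))
              + Ξ (τ (a + j)) (τ (a + (j + 1)))
              + ∑ i ∈ Finset.range m, Ξ (τ (a + (j + 1) + i)) (τ (a + (j + 1) + i + 1)) := by
          conv_lhs => rw [hm]
          rw [Finset.sum_range_add, Finset.sum_range_succ]
          simp only [add_assoc]
        rw [this]; abel
      rw [hsum]
      have hpow2 : (2 : ℝ) ^ (1 - θ) = 2 / 2 ^ θ := by
        rw [Real.rpow_sub (by norm_num), Real.rpow_one]
      calc _ ≤ K * (w ^ θ / 2 ^ θ) + K * (w ^ θ / 2 ^ θ) + C * w ^ θ + C * w ^ θ := by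
            refine (norm_sub_le _ _).trans (add_le_add ((norm_sub_le _ _).trans
              (add_le_add ((norm_add_le _ _).trans (add_le_add e1' e2')) e3)) e4')
        _ = (2 ^ (1 - θ) * K + 2 * C) * w ^ θ := by rw [hpow2]; ring
        _ = K * w ^ θ := by rw [hKeq]

/-- A partition says nothing about indices beyond `k`; freezing the sequence at its endpoint makes
it monotone on all of `ℕ`. -/
theorem exists_monotone_partition {s t : ℝ} {k : ℕ} {τ : ℕ → ℝ} (h : IsPartition s t k τ)
    (hs : 0 ≤ s) (ht : t ≤ T) : ∃ σ : ℕ → ℝ, Monotone σ ∧ (∀ i, 0 ≤ σ i ∧ σ i ≤ T) ∧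
      ∀ i ≤ k, σ i = τ i := by
  have hmono : Monotone fun i => τ (min i k) := by
    refine monotone_nat_of_le_succ fun i => ?_
    rcases lt_or_ge i k with hi | hi
    · simp only [min_eq_left hi.le, min_eq_left (Nat.succ_le_of_lt hi)]
      exact h.mono i hi
    · simp only [min_eq_right hi, min_eq_right (hi.trans i.le_succ), le_refl]
  refine ⟨_, hmono, fun i => ⟨?_, ?_⟩, fun i hi => by simp only [min_eq_left hi]⟩
  · have := hmono (Nat.zero_le i)
    simp only [Nat.zero_min, h.left] at this
    exact hs.trans this
  · have := hmono (le_max_left i k)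
    simp only [min_eq_right (le_max_right i k), h.right] at this
    exact this.trans ht

theorem IsAdditive.sum_eq {J : ℝ → ℝ → W} (hJ : IsAdditive T J) {τ : ℕ → ℝ} (hτ : Monotone τ)
    (hτT : ∀ i, 0 ≤ τ i ∧ τ i ≤ T) (n : ℕ) :
    ∑ i ∈ Finset.range n, J (τ i) (τ (i + 1)) = J (τ 0) (τ n) := by
  induction n with
  | zero =>
    have := hJ (τ 0) (τ 0) (τ 0) (hτT 0).1 le_rfl le_rfl (hτT 0).2
    rw [Finset.range_zero, Finset.sum_empty, eq_comm]
    simpa using this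
  | succ n ih =>
    rw [Finset.sum_range_succ, ih, hJ _ _ _ (hτT 0).1 (hτ (Nat.zero_le _)) (hτ n.le_succ) (hτT _).2]

/-- `J s t` is itself the sum of `J` over the cells, so the error of a Riemann sum is at most a
constant times the sum of `ω ^ θ` over the cells. No Cauchy argument for refinements is needed. -/
theorem IsAdditive.riemannSumsTendsto {J : ℝ → ℝ → W} (hJ : IsAdditive T J) (hω : IsControl T ω)
    (hθ : 1 < θ) (hJΞ : ∀ s t, 0 ≤ s → s ≤ t → t ≤ T → ‖J s t - Ξ s t‖ ≤ C * ω s t ^ θ)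
    {s t : ℝ} (hs : 0 ≤ s) (hst : s ≤ t) (ht : t ≤ T) : RiemannSumsTendsto Ξ s t (J s t) := by
  intro k τ hτ hmesh
  rw [Metric.tendsto_atTop']
  intro ε hε
  have hω0 : 0 ≤ ω 0 T := hω.nonneg 0 T le_rfl (by linarith) le_rfl
  -- The added ones keep the denominator positive and the final inequality strict, even if `C` or `ω
  -- 0 T` is zero.
  have hη : 0 < ε / ((|C| + 1) * (ω 0 T + 1)) := by positivity
  obtain ⟨δ, hδ, H⟩ := hω.exists_sum_rpow_le hθ hη
  obtain ⟨n₀, hn₀⟩ := Filter.eventually_atTop.1 (hmesh δ hδ)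
  refine ⟨n₀, fun n hn => ?_⟩
  obtain ⟨σ, hσ, hσT, hστ⟩ := exists_monotone_partition (hτ n) hs ht
  have hm : ∀ i < k n, σ (i + 1) - σ i < δ := fun i hi => by
    rw [hστ i hi.le, hστ (i + 1) hi]; exact hn₀ n hn.le i hi
  have hsum : ∑ i ∈ Finset.range (k n), Ξ (τ n i) (τ n (i + 1))
      = ∑ i ∈ Finset.range (k n), Ξ (σ i) (σ (i + 1)) :=
    Finset.sum_congr rfl fun i hi => by
      rw [hστ i (Finset.mem_range.1 hi).le, hστ (i + 1) (Finset.mem_range.1 hi)]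
  have hJs : J s t = ∑ i ∈ Finset.range (k n), J (σ i) (σ (i + 1)) := by
    rw [hJ.sum_eq hσ hσT, hστ 0 (Nat.zero_le _), hστ (k n) le_rfl, (hτ n).left, (hτ n).right]
  rw [dist_comm, hsum, hJs, dist_eq_norm, ← Finset.sum_sub_distrib]
  have hterm : ∀ i ∈ Finset.range (k n), ‖J (σ i) (σ (i + 1)) - Ξ (σ i) (σ (i + 1))‖
      ≤ |C| * ω (σ i) (σ (i + 1)) ^ θ := fun i _ =>
    (hJΞ _ _ (hσT i).1 (hσ i.le_succ) (hσT (i + 1)).2).trans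
      (mul_le_mul_of_nonneg_right (le_abs_self C)
        (Real.rpow_nonneg (hω.nonneg _ _ (hσT i).1 (hσ i.le_succ) (hσT (i + 1)).2) _))
  calc _ ≤ |C| * (ε / ((|C| + 1) * (ω 0 T + 1)) * ω 0 T) := by
        refine (norm_sum_le_of_le _ hterm).trans ?_
        rw [← Finset.mul_sum]
        exact mul_le_mul_of_nonneg_left (H _ _ hσ hσT hm) (abs_nonneg C)
    _ = ε * ((|C| / (|C| + 1)) * (ω 0 T / (ω 0 T + 1))) := by field_simp
    _ < ε * 1 := by
        refine mul_lt_mul_of_pos_left ?_ hε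
        have h1 : |C| / (|C| + 1) < 1 := by rw [div_lt_one (by positivity)]; linarith
        have h2 : ω 0 T / (ω 0 T + 1) < 1 := by rw [div_lt_one (by positivity)]; linarith
        exact mul_lt_one_of_nonneg_of_lt_one_left (by positivity) h1 h2.le
    _ = ε := mul_one ε

/-- The equidistant grid on `[0, T]`, clamped to `[s, t]`. -/
def clampGrid (T s t : ℝ) (n : ℕ) (i : ℕ) : ℝ := max s (min t (i * (T / (n + 1))))

theorem clampGrid_mono {s t : ℝ} (hT : 0 ≤ T) (n : ℕ) : Monotone (clampGrid T s t n) := by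
  intro i j hij
  have : (i : ℝ) * (T / (n + 1)) ≤ j * (T / (n + 1)) :=
    mul_le_mul_of_nonneg_right (by exact_mod_cast hij) (by positivity)
  exact max_le_max le_rfl (min_le_min le_rfl this)

theorem clampGrid_mem {s t : ℝ} (hst : s ≤ t) (n i : ℕ) :
    s ≤ clampGrid T s t n i ∧ clampGrid T s t n i ≤ t :=
  ⟨le_max_left _ _, max_le hst (min_le_left _ _)⟩

theorem isPartition_clampGrid {s t : ℝ} (hs : 0 ≤ s) (hst : s ≤ t) (ht : t ≤ T) (n : ℕ) :
    IsPartition s t (n + 1) (clampGrid T s t n) where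
  left := by simp [clampGrid, hs]
  right := by
    have : ((n + 1 : ℕ) : ℝ) * (T / (n + 1)) = T := by push_cast; field_simp
    rw [clampGrid, this, min_eq_left ht, max_eq_right hst]
  mono i _ := clampGrid_mono (hs.trans (hst.trans ht)) n i.le_succ

theorem clampGrid_mesh {s t : ℝ} (n i : ℕ) (hT : 0 ≤ T) :
    clampGrid T s t n (i + 1) - clampGrid T s t n i ≤ T / (n + 1) := by
  have h : 0 ≤ T / ((n : ℝ) + 1) := by positivity
  rw [sub_le_iff_le_add, clampGrid, clampGrid]
  push_cast
  rw [add_mul, one_mul, add_comm (T / ((n : ℝ) + 1))]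
  refine max_le (by linarith [le_max_left s (min t (i * (T / (n + 1))))]) ?_
  have : min t (i * (T / (n + 1)) + T / (n + 1)) ≤ min t (i * (T / (n + 1))) + T / (n + 1) := by
    rw [min_add]
    exact min_le_min (by linarith) le_rfl
  linarith [le_max_right s (min t (i * (T / (n + 1))))]

theorem clampGrid_eventually_mesh {s t : ℝ} (hT : 0 ≤ T) {δ : ℝ} (hδ : 0 < δ) :
    ∀ᶠ n : ℕ in Filter.atTop, ∀ i < n + 1, clampGrid T s t n (i + 1) - clampGrid T s t n i < δ := by
  have : Filter.Tendsto (fun n : ℕ => T / ((n : ℝ) + 1)) Filter.atTop (nhds 0) :=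
    tendsto_const_div_atTop_nhds_zero_nat T |>.comp (Filter.tendsto_add_atTop_nat 1) |>.congr
      fun n => by simp
  filter_upwards [this.eventually (gt_mem_nhds hδ)] with n hn i _
  exact (clampGrid_mesh n i hT).trans_lt hn

theorem RiemannSumsTendsto.unique {s t : ℝ} (hs : 0 ≤ s) (hst : s ≤ t) (ht : t ≤ T) {w w' : W}
    (h : RiemannSumsTendsto Ξ s t w) (h' : RiemannSumsTendsto Ξ s t w') : w = w' :=
  have hT := hs.trans (hst.trans ht)
  tendsto_nhds_unique
    (h (fun n => n + 1) (clampGrid T s t) (isPartition_clampGrid hs hst ht)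
      fun _ hδ => clampGrid_eventually_mesh hT hδ)
    (h' (fun n => n + 1) (clampGrid T s t) (isPartition_clampGrid hs hst ht)
      fun _ hδ => clampGrid_eventually_mesh hT hδ)

/-- The Riemann sum of `Ξ` along the clamped grid. -/
def gridSum (T : ℝ) (Ξ : ℝ → ℝ → W) (s t : ℝ) (n : ℕ) : W :=
  ∑ i ∈ Finset.range (n + 1), Ξ (clampGrid T s t n i) (clampGrid T s t n (i + 1))

theorem AlmostAdditive.norm_gridSum_sub_le (h : AlmostAdditive T θ C ω Ξ) (hω : IsControl T ω)
    (hθ : 1 < θ) (hC : 0 ≤ C) {s t : ℝ} (hs : 0 ≤ s) (hst : s ≤ t) (ht : t ≤ T) (n : ℕ) :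
    ‖gridSum T Ξ s t n - Ξ s t‖ ≤ 2 * C / (1 - 2 ^ (1 - θ)) * ω s t ^ θ := by
  have hP := isPartition_clampGrid hs hst ht n
  have := h.norm_sum_sub_le hω hθ hC (clampGrid_mono (s := s) (t := t) (hs.trans (hst.trans ht)) n)
    (fun i => ⟨hs.trans (clampGrid_mem hst n i).1, (clampGrid_mem hst n i).2.trans ht⟩) (n + 1) 0
  simp only [zero_add, hP.left, hP.right] at this
  exact this

/-- Only a cell that contains `u` is really cut; for any other cell one of the two pieces
degenerates to `(u, u)`, where the germ vanishes. -/
theorem AlmostAdditive.norm_clamp_le (h : AlmostAdditive T θ C ω Ξ) (hω : IsControl T ω)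
    (hθ : 1 < θ) (hC : 0 ≤ C) {a b u : ℝ} (ha : 0 ≤ a) (hab : a ≤ b) (hb : b ≤ T) (hu : 0 ≤ u)
    (huT : u ≤ T) :
    ‖Ξ a b - Ξ (min u a) (min u b) - Ξ (max u a) (max u b)‖ ≤ C * ω a b ^ θ := by
  have h0 := Real.rpow_nonneg (hω.nonneg a b ha hab hb) θ
  rcases le_total u a with hua | hua
  · rw [min_eq_left hua, min_eq_left (hua.trans hab), max_eq_right hua,
      max_eq_right (hua.trans hab), h.diag hω hθ hu huT]
    simpa using mul_nonneg hC h0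
  rcases le_total u b with hub | hub
  · rw [min_eq_right hua, min_eq_left hub, max_eq_left hua, max_eq_right hub]
    exact h a u b ha hua hub hb
  · rw [min_eq_right hua, min_eq_right hub, max_eq_left hua, max_eq_left hub, h.diag hω hθ hu huT]
    simpa using mul_nonneg hC h0

theorem AlmostAdditive.tendsto_gridSum_defect (h : AlmostAdditive T θ C ω Ξ) (hω : IsControl T ω)
    (hθ : 1 < θ) (hC : 0 ≤ C) {s u t : ℝ} (hs : 0 ≤ s) (hsu : s ≤ u) (hut : u ≤ t) (ht : t ≤ T) :
    Filter.Tendsto (fun n => gridSum T Ξ s t n - gridSum T Ξ s u n - gridSum T Ξ u t n)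
      Filter.atTop (nhds 0) := by
  have hT : 0 ≤ T := by linarith
  have hst := hsu.trans hut
  have hω0 : 0 ≤ ω 0 T := hω.nonneg 0 T le_rfl hT le_rfl
  rw [Metric.tendsto_atTop']
  intro ε hε
  obtain ⟨δ, hδ, H⟩ := hω.exists_sum_rpow_le hθ
    (show 0 < ε / ((C + 1) * (ω 0 T + 1)) by positivity)
  obtain ⟨n₀, hn₀⟩ := Filter.eventually_atTop.1 (clampGrid_eventually_mesh (s := s) (t := t) hT hδ)
  refine ⟨n₀, fun n hn => ?_⟩
  -- The grids of `[s, u]` and `[u, t]` are clampings of the grid of `[s, t]` with the same indices,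
  -- so the three Riemann sums can be compared cell by cell.
  have hmin : ∀ i, clampGrid T s u n i = min u (clampGrid T s t n i) := fun i => by
    simp only [clampGrid]
    rw [max_min_distrib_left, max_min_distrib_left, max_eq_right hsu, max_eq_right hst, ← min_assoc,
      min_eq_left hut]
  have hmax : ∀ i, clampGrid T u t n i = max u (clampGrid T s t n i) := fun i => by
    simp only [clampGrid]
    rw [← max_assoc, max_eq_left hsu]
  have hmem : ∀ i, 0 ≤ clampGrid T s t n i ∧ clampGrid T s t n i ≤ T := fun i =>
    ⟨hs.trans (clampGrid_mem hst n i).1, (clampGrid_mem hst n i).2.trans ht⟩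
  have hS := H (n + 1) _ (clampGrid_mono (s := s) (t := t) hT n) hmem (hn₀ n hn.le)
  rw [dist_zero_right, gridSum, gridSum, gridSum, ← Finset.sum_sub_distrib,
    ← Finset.sum_sub_distrib]
  simp only [hmin, hmax]
  refine (norm_sum_le_of_le _ fun i _ => h.norm_clamp_le hω hθ hC (hmem i).1
    (clampGrid_mono hT n i.le_succ) (hmem (i + 1)).2 (hs.trans hsu) (hut.trans ht)).trans_lt ?_
  rw [← Finset.mul_sum]
  refine (mul_le_mul_of_nonneg_left hS hC).trans_lt ?_
  calc C * (ε / ((C + 1) * (ω 0 T + 1)) * ω 0 T)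
      = ε * ((C / (C + 1)) * (ω 0 T / (ω 0 T + 1))) := by field_simp
    _ < ε * 1 := by
        refine mul_lt_mul_of_pos_left ?_ hε
        have h1 : C / (C + 1) < 1 := by rw [div_lt_one (by positivity)]; linarith
        have h2 : ω 0 T / (ω 0 T + 1) < 1 := by rw [div_lt_one (by positivity)]; linarith
        exact mul_lt_one_of_nonneg_of_lt_one_left (by positivity) h1 h2.le
    _ = ε := mul_one ε

/-- The sewing lemma: an almost additive germ of order `θ > 1` is close to an additive function. -/
theorem AlmostAdditive.exists_isAdditive [ProperSpace W] (h : AlmostAdditive T θ C ω Ξ)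
    (hω : IsControl T ω) (hθ : 1 < θ) (hC : 0 ≤ C) : ∃ I : ℝ → ℝ → W, IsAdditive T I ∧
      ∀ s t, 0 ≤ s → s ≤ t → t ≤ T →
        ‖I s t - Ξ s t‖ ≤ 2 * C / (1 - 2 ^ (1 - θ)) * ω s t ^ θ := by
  have hex : ∀ s t, ∃ w : W, 0 ≤ s → s ≤ t → t ≤ T →
      Filter.Tendsto (gridSum T Ξ s t) (Filter.hyperfilter ℕ) (nhds w) ∧
        ‖w - Ξ s t‖ ≤ 2 * C / (1 - 2 ^ (1 - θ)) * ω s t ^ θ := by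
    intro s t
    by_cases hc : 0 ≤ s ∧ s ≤ t ∧ t ≤ T
    · obtain ⟨hs, hst, ht⟩ := hc
      have hb : ∀ n, gridSum T Ξ s t n
          ∈ Metric.closedBall (Ξ s t) (2 * C / (1 - 2 ^ (1 - θ)) * ω s t ^ θ) := fun n => by
        rw [Metric.mem_closedBall, dist_eq_norm]
        exact h.norm_gridSum_sub_le hω hθ hC hs hst ht n
      -- The grid sums stay in a compact ball, hence converge along the ultrafilter, and the limit
      -- inherits the estimate. As the same ultrafilter serves all `(s, t)`, the limits for `[s,
      -- u]`, `[u, t]` and `[s, t]` can be combined.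
      obtain ⟨w, hw, hlim⟩ := (isCompact_closedBall (Ξ s t)
        (2 * C / (1 - 2 ^ (1 - θ)) * ω s t ^ θ)).ultrafilter_le_nhds
          ((Filter.hyperfilter ℕ).map (gridSum T Ξ s t))
          (Filter.le_principal_iff.2 (Filter.mem_map.2 (Filter.Eventually.of_forall hb)))
      rw [Metric.mem_closedBall, dist_eq_norm] at hw
      exact ⟨w, fun _ _ _ => ⟨hlim, hw⟩⟩
    · exact ⟨0, fun h1 h2 h3 => absurd ⟨h1, h2, h3⟩ hc⟩
  choose I hI using hex
  refine ⟨I, fun s u t hs hsu hut ht => ?_, fun s t hs hst ht => (hI s t hs hst ht).2⟩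
  have h1 := (hI s u hs hsu (hut.trans ht)).1
  have h2 := (hI u t (hs.trans hsu) hut ht).1
  have h3 := (hI s t hs (hsu.trans hut) ht).1
  have h4 := (h.tendsto_gridSum_defect hω hθ hC hs hsu hut ht).mono_left
    Nat.hyperfilter_le_atTop
  have := tendsto_nhds_unique ((h3.sub h1).sub h2) h4
  rw [sub_sub, sub_eq_zero] at this
  exact this.symm

end Sewing

/-! ### Weights, and the identities relating `⊤` and `π`. -/

namespace CK

variable {ι : Type*}

/-- The span of the forests of weight `n`. -/
def homC (ι : Type*) (n : ℕ) : Submodule ℝ (CK ι) :=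
  Submodule.span ℝ {z | ∃ f : Forest ι, f.weight = n ∧ z = of f}

theorem of_mem_homC {f : Forest ι} {n : ℕ} (h : f.weight = n) : of f ∈ homC ι n :=
  Submodule.subset_span ⟨f, h, rfl⟩

theorem homC_mul {m n : ℕ} {x y : CK ι} (hx : x ∈ homC ι m) (hy : y ∈ homC ι n) :
    x * y ∈ homC ι (m + n) := by
  induction hx using Submodule.span_induction with
  | zero => simp
  | add x y _ _ hx hy => rw [add_mul]; exact add_mem hx hy
  | smul c x _ hx => rw [smul_mul_assoc]; exact Submodule.smul_mem _ _ hx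
  | mem x hx =>
    obtain ⟨f, hf, rfl⟩ := hx
    induction hy using Submodule.span_induction with
    | zero => simp
    | add x y _ _ hx hy => rw [mul_add]; exact add_mem hx hy
    | smul c x _ hx => rw [mul_smul_comm]; exact Submodule.smul_mem _ _ hx
    | mem y hy =>
      obtain ⟨g, hg, rfl⟩ := hy
      rw [← of_mul]
      exact of_mem_homC (by rw [weight_mul, hf, hg])

theorem homC_bplus (a : ι) {n : ℕ} {x : CK ι} (hx : x ∈ homC ι n) :
    bplus a x ∈ homC ι (n + 1) := by
  induction hx using Submodule.span_induction with
  | zero => simp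
  | add x y _ _ hx hy => rw [map_add]; exact add_mem hx hy
  | smul c x _ hx => rw [map_smul]; exact Submodule.smul_mem _ _ hx
  | mem x hx =>
    obtain ⟨f, hf, rfl⟩ := hx
    rw [bplus_of]
    exact of_mem_homC (by rw [weight_bplus, hf])

theorem graft_mem_homC (f g : Forest ι) : graft f g ∈ homC ι (f.weight + g.weight) := by
  induction g using Forest.ind with
  | one => exact zero_mem _
  | step a k g hk hg =>
    rw [graft_step, weight_mul, weight_bplus]
    refine add_mem (add_mem (of_mem_homC ?_) ?_) ?_
    · rw [weight_mul, weight_bplus, weight_mul]; omega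
    · have := homC_mul (homC_bplus a hk) (of_mem_homC (f := g) rfl)
      rwa [show f.weight + k.weight + 1 + g.weight = f.weight + (k.weight + 1 + g.weight) by omega]
        at this
    · have := homC_mul (of_mem_homC (weight_bplus a k)) hg
      rwa [show k.weight + 1 + (f.weight + g.weight) = f.weight + (k.weight + 1 + g.weight) by omega]
        at this

theorem top_of_mem_homC (f g : Forest ι) :
    top (of f) (of g) ∈ homC ι (f.weight + g.weight) := by
  simp only [top, extend_of]
  exact Submodule.smul_mem _ _ (graft_mem_homC f g)

theorem top_mem_homC (f : Forest ι) {n : ℕ} {y : CK ι} (hy : y ∈ homC ι n) :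
    top (of f) y ∈ homC ι (f.weight + n) := by
  induction hy using Submodule.span_induction with
  | zero => simp
  | add x y _ _ hx hy => rw [map_add]; exact add_mem hx hy
  | smul c x _ hx => rw [map_smul]; exact Submodule.smul_mem _ _ hx
  | mem y hy =>
    obtain ⟨g, hg, rfl⟩ := hy
    rw [← hg]
    exact top_of_mem_homC f g

/-- The coproduct and `⊤` respect weights, so the recursion for `π` does too. -/
theorem piLin_of_mem_homC (n : ℕ) : ∀ f : Forest ι, f.weight = n → piLin (of f) ∈ homC ι n := by
  induction n using Nat.strong_induction_on with
  | _ n ih =>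
    intro f hf
    rw [piLin_eq]
    refine sub_mem ?_ ?_
    · by_cases h : f.weight = 0
      · rw [eq_one_of_weight h, of_one, pos_one]; exact zero_mem _
      · rw [pos_of h]; exact of_mem_homC hf
    · rw [redComul_apply]
      have hmem := comul_mem_homT f
      rw [hf] at hmem
      generalize comul (of f) = u at hmem
      induction hmem using Submodule.span_induction with
      | zero => simp
      | add x y _ _ hx hy => simp only [map_add]; exact add_mem hx hy
      | smul c x _ hx => simp only [map_smul]; exact Submodule.smul_mem _ _ hx
      | mem x hx =>
        obtain ⟨g, h, hgh, rfl⟩ := hx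
        rw [TensorProduct.map_tmul]
        by_cases hg : g.weight = 0
        · rw [eq_one_of_weight hg, of_one, pos_one, TensorProduct.zero_tmul, map_zero, map_zero]
          exact zero_mem _
        by_cases hh : h.weight = 0
        · rw [eq_one_of_weight hh, of_one, pos_one, TensorProduct.tmul_zero, map_zero, map_zero]
          exact zero_mem _
        rw [pos_of hg, pos_of hh, LinearMap.lTensor_tmul, TensorProduct.lift.tmul, ← hgh]
        exact top_mem_homC g (ih _ (by omega) h rfl)

theorem piLin_primitive {p : CK ι} (hp : p ∈ primitives ι) : piLin p = p :=
  congrArg Subtype.val (proj_primitive ⟨p, hp⟩)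

theorem counit_primitive {p : CK ι} (hp : p ∈ primitives ι) : counit p = 0 := by
  rw [← piLin_primitive hp, counit_piLin]

theorem piLin_one : piLin (1 : CK ι) = 0 := by
  rw [piLin_eq, redComul_one, map_zero, map_zero, pos_one, sub_zero]

/-- Both legs of the reduced coproduct lie in the augmentation ideal. -/
theorem lTensor_counit_redComul (x p : CK ι) :
    (counit.smulRight p).lTensor (CK ι) (redComul x) = 0 := by
  rw [redComul_apply]
  induction comul x with
  | zero => simp
  | add X Y hX hY => rw [map_add, map_add, hX, hY, add_zero]
  | tmul a b => simp [counit_pos]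

/-- For nonempty `f`, `Δ̃(f ⊤ p) = f ⊗ p + f' ⊗ (f'' ⊤ p)`. Under `⊤ ∘ (id ⊗ π)` the first term
gives `f ⊤ p`. The second vanishes, by induction, as `ε(f'') = 0`. So the recursion for `π` reads `f
⊤ p - f ⊤ p`. -/
theorem piLin_top_of {p : CK ι} (hp : p ∈ primitives ι) (n : ℕ) :
    ∀ f : Forest ι, f.weight = n → piLin (top (of f) p) = counit (of f) • p := by
  induction n using Nat.strong_induction_on with
  | _ n ih =>
    intro f hf
    by_cases h : f.weight = 0
    · rw [eq_one_of_weight h, of_one, top_one, counit_one, one_smul, pos_eq, counit_primitive hp,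
        zero_smul, sub_zero, piLin_primitive hp]
    · rw [piLin_eq, redComul_top (counit_of h) hp (counit_primitive hp), map_add, map_add,
        LinearMap.lTensor_tmul, TensorProduct.lift.tmul, piLin_primitive hp, ← LinearMap.comp_apply
        (LinearMap.lTensor _ _) (LinearMap.lTensor _ _), ← LinearMap.lTensor_comp,
        lTensor_congr_lowT (ψ := counit.smulRight p) (fun g hg => ?_) (redComul_mem_lowT f),
        lTensor_counit_redComul, map_zero, add_zero, pos_eq, counit_top, zero_smul, sub_zero,
        sub_self, counit_of h, zero_smul]
      exact ih g.weight (by omega) g rfl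

/-- `π (x ⊤ p) = ε(x) p` for primitive `p`. -/
theorem piLin_top (x : CK ι) {p : CK ι} (hp : p ∈ primitives ι) :
    piLin (top x p) = counit x • p := by
  have : piLin ∘ₗ top.flip p = counit.smulRight p := lin_ext fun f => piLin_top_of hp _ f rfl
  exact congrArg (fun φ => φ x) this

/-- `x₍₁₎ ⊤ π(x₍₂₎) = x - ε(x) 1`. -/
theorem lift_top_comul (x : CK ι) :
    TensorProduct.lift top (piLin.lTensor (CK ι) (comul x)) = pos x := by
  have : TensorProduct.lift top ∘ₗ piLin.lTensor (CK ι) ∘ₗ comul.toLinearMap = pos (ι := ι) := by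
    refine of_zero_weight _ _ ?_ fun f h => ?_
    · simp only [LinearMap.comp_apply, AlgHom.toLinearMap_apply, map_one, pos_one,
        Algebra.TensorProduct.one_def, LinearMap.lTensor_tmul, piLin_one, TensorProduct.tmul_zero,
        map_zero]
    · simp only [LinearMap.comp_apply, AlgHom.toLinearMap_apply]
      -- `x ⊗ 1` contributes nothing since `π(1) = 0`, `1 ⊗ x` contributes `1 ⊤ π(x) = π(x)`, and
      -- `Δ̃ x` contributes exactly what the recursion subtracts from `x` to form `π(x)`.
      rw [comul_eq (counit_of h), map_add, map_add, map_add, map_add, LinearMap.lTensor_tmul,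
        LinearMap.lTensor_tmul, piLin_one, TensorProduct.tmul_zero, map_zero, zero_add,
        TensorProduct.lift.tmul, top_one, pos_eq (piLin _), counit_piLin, zero_smul, sub_zero,
        piLin_eq, sub_add_cancel]
  exact congrArg (fun φ => φ x) this

end CK

/-! ### Duality: truncations, the product `⋆`, and the components `topQ` in `𝒬`. -/

open CK Asymptotics Filter

variable {ι : Type*}

theorem HGL_mono {m n : ℕ} (h : m ≤ n) : HGL ι m ≤ HGL ι n :=
  fun _ hx f hf => hx f (h.trans_lt hf)

theorem HGLHom_le (n : ℕ) : HGLHom ι n ≤ HGL ι n := fun _ hx f hf => hx f hf.ne'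

theorem HGL_apply_homC {m n : ℕ} {x : CKDual ι} (hx : x ∈ HGL ι m) {z : CK ι} (hz : z ∈ homC ι n)
    (h : m < n) : x z = 0 := by
  induction hz using Submodule.span_induction with
  | zero => simp
  | add y z _ _ hy hz => rw [map_add, hy, hz, add_zero]
  | smul c y _ hy => rw [map_smul, hy, smul_zero]
  | mem y hy =>
    obtain ⟨f, hf, rfl⟩ := hy
    exact hx f (by omega)

theorem trunc_of (N : ℕ) (x : CKDual ι) (f : Forest ι) :
    (trunc N x : CKDual ι) (of f) = if f.weight ≤ N then x (of f) else 0 := by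
  change x (CK.extend _ (CK.of f)) = _
  rw [CK.extend_of]
  split_ifs <;> simp

theorem trunc_homC {N n : ℕ} (x : CKDual ι) {z : CK ι} (hz : z ∈ homC ι n) :
    (trunc N x : CKDual ι) z = if n ≤ N then x z else 0 := by
  induction hz using Submodule.span_induction with
  | zero => simp
  | add y z _ _ hy hz => rw [map_add, map_add, hy, hz]; split_ifs <;> simp
  | smul c y _ hy => rw [map_smul, map_smul, hy]; split_ifs <;> simp
  | mem y hy =>
    obtain ⟨f, rfl, rfl⟩ := hy
    exact trunc_of N x f

theorem trunc_eq_self {N : ℕ} {x : CKDual ι} (hx : x ∈ HGL ι N) : trunc N x = ⟨x, hx⟩ :=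
  Subtype.ext (lin_ext fun f => by
    rw [trunc_of]
    split_ifs with h
    · rfl
    · exact (hx f (by omega)).symm)

theorem coe_trunc_eq_self {N : ℕ} {x : CKDual ι} (hx : x ∈ HGL ι N) :
    (trunc N x : CKDual ι) = x := by rw [trunc_eq_self hx]

theorem trunc_coe {N : ℕ} (x : HGL ι N) : trunc N (x : CKDual ι) = x := trunc_eq_self x.2

theorem mem_forestsLE [Finite ι] {n : ℕ} {f : Forest ι} : f ∈ forestsLE ι n ↔ f.weight ≤ n := by
  simp [forestsLE]

theorem trunc_eq_sum [Finite ι] (N : ℕ) (x : CKDual ι) :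
    trunc N x = ∑ f ∈ forestsLE ι N, x (of f) • trunc N (coord f) := by
  refine Subtype.ext (lin_ext fun g => ?_)
  rw [AddSubmonoidClass.coe_finsetSum, LinearMap.sum_apply, trunc_of]
  simp only [Submodule.coe_smul, LinearMap.smul_apply, trunc_of]
  split_ifs with h
  · rw [Finset.sum_eq_single_of_mem g (mem_forestsLE.2 h), coord_of_self, smul_eq_mul, mul_one]
    intro f _ hf
    rw [coord_of_ne hf, smul_zero]
  · simp

theorem coord_one : coord (1 : Forest ι) = counit := lin_ext fun f => by
  by_cases h : f.weight = 0
  · rw [eq_one_of_weight h, coord_of_self, of_one, counit_one]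
  · rw [counit_of h, coord_of_ne]
    rintro rfl
    exact h weight_one

/-- `x ⊗ y`, as a linear form on `H_CK ⊗ H_CK`. -/
def tens (x y : CKDual ι) : CK ι ⊗[ℝ] CK ι →ₗ[ℝ] ℝ := LinearMap.mul' ℝ ℝ ∘ₗ TensorProduct.map x y

theorem tens_tmul (x y : CKDual ι) (a b : CK ι) : tens x y (a ⊗ₜ b) = x a * y b := rfl

theorem glMul_apply (x y : CKDual ι) (z : CK ι) : glMul x y z = tens x y (comul z) := rfl

theorem glMul_one (x y : CKDual ι) : glMul x y 1 = x 1 * y 1 := by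
  rw [glMul_apply, map_one, Algebra.TensorProduct.one_def, tens_tmul]

theorem glMul_coord_one (x : CKDual ι) : glMul x (coord 1) = x := by
  refine LinearMap.ext fun z => ?_
  have : ∀ u : CK ι ⊗[ℝ] CK ι, tens x (coord 1) u = x (idCounit u) := fun u => by
    induction u with
    | zero => simp
    | add X Y hX hY => simp only [map_add, hX, hY]
    | tmul a b => rw [tens_tmul, idCounit_tmul, map_smul, coord_one, smul_eq_mul, mul_comm]
  rw [glMul_apply, this, idCounit_comul]

theorem glMul_mem {m n : ℕ} {x y : CKDual ι} (hx : x ∈ HGL ι m) (hy : y ∈ HGL ι n) :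
    glMul x y ∈ HGL ι (m + n) := by
  intro f hf
  rw [glMul_apply]
  have hmem := comul_mem_homT f
  generalize comul (of f) = u at hmem
  induction hmem using Submodule.span_induction with
  | zero => simp
  | add x y _ _ hx hy => rw [map_add, hx, hy, add_zero]
  | smul c x _ hx => rw [map_smul, hx, smul_zero]
  | mem u hu =>
    obtain ⟨g, h, hgh, rfl⟩ := hu
    rw [tens_tmul]
    rcases lt_or_ge m g.weight with hg | hg
    · rw [hx g hg, zero_mul]
    · rw [hy h (by omega), mul_zero]

/-- The transpose of `comul_top`, with the second leg of `Δ f` expanded in forests; these have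
weight at most `|f|`, so the finite sum suffices. -/
theorem glMul_top [Finite ι] (x y : CKDual ι) {M : ℕ} {f : Forest ι} (hf : f.weight ≤ M) {p : CK ι}
    (hp : p ∈ primitives ι) :
    glMul x y (top (of f) p) = y 1 * x (top (of f) p)
      + ∑ g ∈ forestsLE ι M, glMul x (coord g) (of f) * y (top (of g) p) := by
  rw [glMul_apply, comul_top _ hp, map_add, tens_tmul, mul_comm]
  simp only [glMul_apply]
  congr 1
  have hmem := comul_mem_homT f
  generalize comul (of f) = u at hmem
  induction hmem using Submodule.span_induction with
  | zero => simp
  | add x y _ _ hx hy => simp only [map_add, hx, hy, add_mul, Finset.sum_add_distrib]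
  | smul c x _ hx => simp only [map_smul, hx, smul_mul_assoc, Finset.smul_sum]
  | mem u hu =>
    obtain ⟨a, b, hab, rfl⟩ := hu
    simp only [LinearMap.lTensor_tmul, tens_tmul, LinearMap.flip_apply]
    rw [Finset.sum_eq_single_of_mem b (mem_forestsLE.2 (by omega)), coord_of_self, mul_one]
    intro g _ hg
    rw [coord_of_ne hg, mul_zero, zero_mul]

/-- The element `k ↦ ⟨g ⊤ π(k), y⟩` of `𝒬^N`. -/
def topQ (N : ℕ) (g : Forest ι) : CKDual ι →ₗ[ℝ] Q ι N :=
  piQ N ∘ₗ trunc N ∘ₗ (top (of g)).dualMap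

theorem topQ_of (N : ℕ) (g : Forest ι) (y : CKDual ι) (k : Forest ι) :
    (topQ N g y : CKDual ι) (of k) = if k.weight ≤ N then y (top (of g) (piLin (of k))) else 0 := by
  change (trunc N ((top (of g)).dualMap y) : CKDual ι) (piLin (of k)) = _
  rw [trunc_homC _ (piLin_of_mem_homC _ k rfl)]
  rfl

/-- The truncation in `topQ` loses nothing: `g ⊤ π(k)` is at least as heavy as `k`, so `y` already
vanishes there when `|k| > N`. -/
theorem topQ_of_mem {M N : ℕ} (h : M ≤ N) (g : Forest ι) {y : CKDual ι} (hy : y ∈ HGL ι M)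
    (z : CK ι) : (topQ N g y : CKDual ι) z = y (top (of g) (piLin z)) := by
  have : (topQ N g y : CKDual ι) = y ∘ₗ top (of g) ∘ₗ piLin := lin_ext fun k => by
    rw [topQ_of]
    split_ifs with hk
    · rfl
    · exact (HGL_apply_homC hy (top_mem_homC g (piLin_of_mem_homC _ k rfl)) (by omega)).symm
  exact congrArg (fun φ => φ z) this

theorem topQ_mem {M N : ℕ} (h : M ≤ N) (g : Forest ι) {y : CKDual ι} (hy : y ∈ HGL ι M) :
    (topQ N g y : CKDual ι) ∈ HGL ι (M - g.weight) := fun k hk => by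
  rw [topQ_of_mem h g hy]
  exact HGL_apply_homC hy (top_mem_homC g (piLin_of_mem_homC _ k rfl)) (by omega)

theorem topQ_eq_sum [Finite ι] (N : ℕ) (g : Forest ι) (y : CKDual ι) :
    topQ N g y = ∑ k ∈ forestsLE ι N, y (top (of g) (of k)) • piQ N (trunc N (coord k)) := by
  change piQ N (trunc N ((top (of g)).dualMap y)) = _
  rw [trunc_eq_sum, map_sum]
  simp only [map_smul]
  rfl

/-- `π` is idempotent, so `π*` fixes its range. -/
theorem Q_apply_piLin {N : ℕ} (q : Q ι N) (z : CK ι) :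
    (q : CKDual ι) (piLin z) = (q : CKDual ι) z := by
  obtain ⟨_, y, -, rfl⟩ := q
  change y (piLin (piLin z)) = y (piLin z)
  rw [piLin_primitive (piLin_mem z)]

theorem Q_apply_one {N : ℕ} (q : Q ι N) : (q : CKDual ι) 1 = 0 := by
  rw [← Q_apply_piLin, piLin_one, map_zero]

theorem Q_le_HGL (N : ℕ) : Q ι N ≤ HGL ι N := by
  rintro _ ⟨y, hy, rfl⟩ f hf
  exact HGL_apply_homC hy (piLin_of_mem_homC _ f rfl) hf

/-- `q(g ⊤ π(z)) = q(π(g ⊤ π(z))) = ε(g) q(π(z))`: an element of `𝒬` has only the component at the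
empty forest. -/
theorem topQ_coe {N : ℕ} (g : Forest ι) (q : Q ι N) :
    topQ N g (q : CKDual ι) = counit (of g) • q := by
  refine Subtype.ext (LinearMap.ext fun z => ?_)
  rw [topQ_of_mem le_rfl g (Q_le_HGL N q.2), ← Q_apply_piLin, piLin_top _ (piLin_mem z), map_smul,
    Q_apply_piLin]
  rfl

theorem topQ_glMul [Finite ι] {M N : ℕ} (x y : CKDual ι) {f : Forest ι} (hf : f.weight ≤ M) :
    topQ N f (glMul x y) = y 1 • topQ N f x
      + ∑ g ∈ forestsLE ι M, glMul x (coord g) (of f) • topQ N g y := by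
  refine Subtype.ext (lin_ext fun k => ?_)
  rw [Submodule.coe_add, AddSubmonoidClass.coe_finsetSum, LinearMap.add_apply,
    LinearMap.sum_apply]
  simp only [Submodule.coe_smul, LinearMap.smul_apply, topQ_of]
  split_ifs with hk
  · rw [glMul_top x y hf (piLin_mem _)]
    rfl
  · simp

/-- Every element of `H_GL` is decomposed with respect to `H_GL = ℝ ⊕ H_GL ⋆ 𝒬`. -/
theorem eq_sum_glMul_topQ [Finite ι] {M N : ℕ} (h : M ≤ N) {x : CKDual ι} (hx : x ∈ HGL ι M)
    {f : Forest ι} (hf : f.weight ≤ M) :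
    x (of f) = x 1 * coord 1 (of f)
      + ∑ g ∈ forestsLE ι M, glMul (coord g) (topQ N g x : CKDual ι) (of f) := by
  have hpos : x (of f) = x 1 * coord 1 (of f) + x (pos (of f)) := by
    rw [pos_eq, map_sub, map_smul, coord_one, smul_eq_mul]; ring
  rw [hpos, ← lift_top_comul]
  simp only [glMul_apply]
  congr 1
  have hmem := comul_mem_homT f
  generalize comul (of f) = u at hmem
  induction hmem using Submodule.span_induction with
  | zero => simp
  | add x y _ _ hx hy => simp only [map_add, hx, hy, Finset.sum_add_distrib]
  | smul c x _ hx => simp only [map_smul, hx, Finset.smul_sum]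
  | mem u hu =>
    obtain ⟨a, b, hab, rfl⟩ := hu
    simp only [LinearMap.lTensor_tmul, tens_tmul, TensorProduct.lift.tmul, topQ_of_mem h _ hx]
    rw [Finset.sum_eq_single_of_mem a (mem_forestsLE.2 (by omega)), coord_of_self, one_mul]
    intro g _ hg
    rw [coord_of_ne hg, zero_mul]

/-! ### The pairing through `⊤*` and its behaviour on products. -/

section Pairing

variable [Finite ι] {W : Type*} [AddCommGroup W] [Module ℝ W] {N : ℕ}

/-- The pairing `topPairing`, extended to functionals on `H_CK` of any weight. -/
def topFull (A : HGL ι (N - 1) →ₗ[ℝ] Q ι N →ₗ[ℝ] W) : CKDual ι →ₗ[ℝ] W :=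
  ∑ f ∈ forestsLE ι (N - 1), A (trunc (N - 1) (coord f)) ∘ₗ topQ N f

theorem topFull_apply (A : HGL ι (N - 1) →ₗ[ℝ] Q ι N →ₗ[ℝ] W) (x : CKDual ι) :
    topFull A x = ∑ f ∈ forestsLE ι (N - 1), A (trunc (N - 1) (coord f)) (topQ N f x) := by
  rw [topFull, LinearMap.sum_apply]
  rfl

theorem topPairing_eq (A : HGL ι (N - 1) →ₗ[ℝ] Q ι N →ₗ[ℝ] W) (x : HGL ι N) :
    topPairing A x = topFull A (x : CKDual ι) := by
  rw [topPairing, topStar, map_sum, topFull_apply]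
  rfl

theorem topFull_eq_sum (A : HGL ι (N - 1) →ₗ[ℝ] Q ι N →ₗ[ℝ] W) (x : CKDual ι) :
    topFull A x = ∑ f ∈ forestsLE ι (N - 1), ∑ k ∈ forestsLE ι N,
      x (top (of f) (of k)) • A (trunc (N - 1) (coord f)) (piQ N (trunc N (coord k))) := by
  rw [topFull_apply]
  refine Finset.sum_congr rfl fun f _ => ?_
  rw [topQ_eq_sum, map_sum]
  simp only [map_smul]

/-- Apply `topQ_glMul` to each component, exchange the two sums, and recognise the inner one as the
expansion of the truncated `x ⋆ g*`. No truncation of `x ⋆ y` is involved, which is why `topFull` is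
defined on the whole dual. -/
theorem topFull_glMul (A : HGL ι (N - 1) →ₗ[ℝ] Q ι N →ₗ[ℝ] W) (x y : CKDual ι) :
    topFull A (glMul x y) = y 1 • topFull A x
      + ∑ g ∈ forestsLE ι (N - 1), A (trunc (N - 1) (glMul x (coord g))) (topQ N g y) := by
  have h1 : ∀ f ∈ forestsLE ι (N - 1), A (trunc (N - 1) (coord f)) (topQ N f (glMul x y))
      = y 1 • A (trunc (N - 1) (coord f)) (topQ N f x)
        + ∑ g ∈ forestsLE ι (N - 1), glMul x (coord g) (of f) •
            A (trunc (N - 1) (coord f)) (topQ N g y) := fun f hf => by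
    rw [topQ_glMul x y (mem_forestsLE.1 hf), map_add, map_smul, map_sum]
    simp only [map_smul]
  rw [topFull_apply, Finset.sum_congr rfl h1, Finset.sum_add_distrib, ← Finset.smul_sum,
    topFull_apply, Finset.sum_comm]
  congr 1
  refine Finset.sum_congr rfl fun g _ => ?_
  rw [trunc_eq_sum (N - 1) (glMul x (coord g)), map_sum, LinearMap.sum_apply]
  simp only [map_smul, LinearMap.smul_apply]

/-- In the product formula `q(1) = 0`, and by `topQ_coe` only the empty forest contributes. -/
theorem topFull_glMul_Q (A : HGL ι (N - 1) →ₗ[ℝ] Q ι N →ₗ[ℝ] W) (h : HGL ι (N - 1)) (q : Q ι N) :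
    topFull A (glMul (h : CKDual ι) (q : CKDual ι)) = A h q := by
  rw [topFull_glMul, Q_apply_one, zero_smul, zero_add, Finset.sum_eq_single_of_mem 1
    (mem_forestsLE.2 (by rw [weight_one]; exact Nat.zero_le _)), glMul_coord_one, topQ_coe, of_one,
    counit_one, one_smul, trunc_coe]
  intro g _ hg
  rw [topQ_coe, counit_of (fun h0 => hg (eq_one_of_weight h0)), zero_smul, map_zero]

theorem topFull_coord_one (A : HGL ι (N - 1) →ₗ[ℝ] Q ι N →ₗ[ℝ] W) :
    topFull A (coord 1) = 0 := by
  rw [topFull_eq_sum]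
  refine Finset.sum_eq_zero fun f _ => Finset.sum_eq_zero fun k _ => ?_
  rw [coord_one, counit_top, zero_smul]

end Pairing

/-! ### Calculus of orders; `=O[𝓟 S]` is a bound with one constant valid on all of `S`. -/

section Powers

variable {P : Type*} {S : Set P} {ρ M : ℝ} {Ω : P → ℝ}

theorem isBigO_rpow_of_le (hρ : 0 < ρ) (h0 : ∀ p ∈ S, 0 ≤ Ω p) (hM : ∀ p ∈ S, Ω p ≤ M) {m n : ℕ}
    (hmn : m ≤ n) :
    (fun p => Ω p ^ ((n : ℝ) / ρ)) =O[𝓟 S] fun p => Ω p ^ ((m : ℝ) / ρ) := by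
  refine isBigO_principal.2 ⟨M ^ (((n - m : ℕ) : ℝ) / ρ), fun p hp => ?_⟩
  have h : (n : ℝ) / ρ = ((n - m : ℕ) : ℝ) / ρ + (m : ℝ) / ρ := by
    rw [← add_div, ← Nat.cast_add, Nat.sub_add_cancel hmn]
  rw [h, Real.rpow_add_of_nonneg (h0 p hp) (by positivity) (by positivity), norm_mul]
  refine mul_le_mul_of_nonneg_right ?_ (norm_nonneg _)
  rw [Real.norm_of_nonneg (Real.rpow_nonneg (h0 p hp) _)]
  exact Real.rpow_le_rpow (h0 p hp) (hM p hp) (by positivity)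

theorem isBigO_rpow_mul (hρ : 0 < ρ) (h0 : ∀ p ∈ S, 0 ≤ Ω p) (m n : ℕ) :
    (fun p => Ω p ^ ((m : ℝ) / ρ) * Ω p ^ ((n : ℝ) / ρ)) =O[𝓟 S]
      fun p => Ω p ^ (((m + n : ℕ) : ℝ) / ρ) := by
  refine isBigO_principal.2 ⟨1, fun p hp => ?_⟩
  rw [Nat.cast_add, add_div, Real.rpow_add_of_nonneg (h0 p hp) (by positivity) (by positivity),
    one_mul]

theorem isBigO_rpow_mono (hρ : 0 < ρ) {Ω' : P → ℝ} (h0 : ∀ p ∈ S, 0 ≤ Ω p)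
    (h : ∀ p ∈ S, Ω p ≤ Ω' p) (m : ℕ) :
    (fun p => Ω p ^ ((m : ℝ) / ρ)) =O[𝓟 S] fun p => Ω' p ^ ((m : ℝ) / ρ) := by
  refine isBigO_principal.2 ⟨1, fun p hp => ?_⟩
  rw [one_mul, Real.norm_of_nonneg (Real.rpow_nonneg (h0 p hp) _),
    Real.norm_of_nonneg (Real.rpow_nonneg ((h0 p hp).trans (h p hp)) _)]
  exact Real.rpow_le_rpow (h0 p hp) (h p hp) (by positivity)

end Powers

/-- Passes from the coordinatewise bounds in `AlmostEq` to norm bounds, using a finite basis. -/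
theorem isBigO_of_forall_dual {W : Type*} [NormedAddCommGroup W] [NormedSpace ℝ W]
    [FiniteDimensional ℝ W] {P : Type*} {l : Filter P} {w : P → W} {r : P → ℝ}
    (h : ∀ φ : Module.Dual ℝ W, (fun p => φ (w p)) =O[l] r) : w =O[l] r := by
  have b := Module.finBasis ℝ W
  have : w = fun p => ∑ i, b.coord i (w p) • b i := funext fun p => (b.sum_repr (w p)).symm
  rw [this]
  refine IsBigO.fun_sum fun i _ => ?_
  have := (h (b.coord i)).smul (isBigO_refl (fun _ : P => b i) l)
  refine this.trans (IsBigO.of_bound ‖b i‖ (Eventually.of_forall fun p => ?_))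
  rw [norm_smul, mul_comm]

/-! ### Orders of pairings and products. -/

section Pairing

variable {ι : Type*} {P : Type*} {l : Filter P} {r r₁ r₂ : P → ℝ}

theorem isBigO_apply_homC {z : P → CKDual ι} {n : ℕ}
    (h : ∀ f : Forest ι, f.weight = n → (fun p => z p (of f)) =O[l] r) {x : CK ι}
    (hx : x ∈ homC ι n) : (fun p => z p x) =O[l] r := by
  induction hx using Submodule.span_induction with
  | zero => simpa using isBigO_zero r l
  | add x y _ _ hx hy => simpa only [map_add] using hx.add hy
  | smul c x _ hx => simpa only [map_smul, smul_eq_mul] using hx.const_mul_left c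
  | mem y hy =>
    obtain ⟨f, hf, rfl⟩ := hy
    exact h f hf

/-- `g ⊤ k` has weight strictly above `|g|` unless `k` is empty, and then it is zero. This supplies
the extra power in the defect estimate. -/
theorem isBigO_apply_top {z : P → CKDual ι} {m : ℕ}
    (h : ∀ f : Forest ι, m < f.weight → (fun p => z p (of f)) =O[l] r) {g k : Forest ι}
    (hg : m ≤ g.weight) : (fun p => z p (top (of g) (of k))) =O[l] r := by
  rcases Nat.eq_zero_or_pos k.weight with hk | hk
  · rw [eq_one_of_weight hk, of_one, top_eq, ← of_one, invW, extend_of, map_smul, of_one, gr_one]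
    simpa using isBigO_zero r l
  · exact isBigO_apply_homC (fun f hf => h f (by omega)) (top_of_mem_homC g k)

theorem isBigO_glMul {x y : P → CKDual ι} {f : Forest ι}
    (h : ∀ g k : Forest ι, g.weight + k.weight = f.weight →
      (fun p => x p (of g) * y p (of k)) =O[l] r) :
    (fun p => glMul (x p) (y p) (of f)) =O[l] r := by
  simp only [glMul_apply]
  have hmem := comul_mem_homT f
  generalize comul (of f) = u at hmem
  induction hmem using Submodule.span_induction with
  | zero => simpa using isBigO_zero r l
  | add x y _ _ hx hy => simpa only [map_add] using hx.add hy
  | smul c x _ hx => simpa only [map_smul, smul_eq_mul] using hx.const_mul_left c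
  | mem u hu =>
    obtain ⟨a, b, hab, rfl⟩ := hu
    exact h a b hab

variable [Finite ι] {W : Type*} [NormedAddCommGroup W] [NormedSpace ℝ W] {N : ℕ}

theorem isBigO_topFull {A : P → HGL ι (N - 1) →ₗ[ℝ] Q ι N →ₗ[ℝ] W}
    (hA : ∀ h q, (fun p => A p h q) =O[l] fun _ => (1 : ℝ)) {z : P → CKDual ι}
    (hz : ∀ f k : Forest ι, (fun p => z p (top (of f) (of k))) =O[l] r) :
    (fun p => topFull (A p) (z p)) =O[l] r := by
  simp only [topFull_eq_sum]
  refine IsBigO.fun_sum fun f _ => IsBigO.fun_sum fun k _ => ?_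
  simpa using (hz f k).smul (hA (trunc (N - 1) (coord f)) (piQ N (trunc N (coord k))))

theorem isBigO_topFull_sub_trunc {A : P → HGL ι (N - 1) →ₗ[ℝ] Q ι N →ₗ[ℝ] W}
    (hA : ∀ h q, (fun p => A p h q) =O[l] fun _ => (1 : ℝ)) {z : P → CKDual ι} {m : ℕ}
    (hz : ∀ f : Forest ι, m < f.weight → (fun p => z p (of f)) =O[l] r) :
    (fun p => topFull (A p) (z p - (trunc m (z p) : CKDual ι))) =O[l] r := by
  refine isBigO_topFull hA fun f k => isBigO_apply_homC (fun g _ => ?_) (top_of_mem_homC f k)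
  simp only [LinearMap.sub_apply, trunc_of]
  rcases le_or_gt g.weight m with hg | hg
  · simpa [hg] using isBigO_zero r l
  · simpa [not_le.2 hg] using hz g hg

theorem isBigO_apply_topQ {D : P → Q ι N →ₗ[ℝ] W} (hD : ∀ q, (fun p => D p q) =O[l] r₁)
    {y : P → CKDual ι} {g : Forest ι}
    (hy : ∀ k : Forest ι, (fun p => y p (top (of g) (of k))) =O[l] r₂) :
    (fun p => D p (topQ N g (y p))) =O[l] fun p => r₁ p * r₂ p := by
  simp only [topQ_eq_sum, map_sum, map_smul]
  refine IsBigO.fun_sum fun k _ => ?_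
  simpa only [smul_eq_mul, mul_comm] using (hy k).smul (hD (piQ N (trunc N (coord k))))

end Pairing

/-! ### Almost equality as a uniform bound on the simplex. -/

/-- The simplex. -/
def simplex (T : ℝ) : Set (ℝ × ℝ) := {p | 0 ≤ p.1 ∧ p.1 ≤ p.2 ∧ p.2 ≤ T}

/-- The ordered triples. -/
def simplex₃ (T : ℝ) : Set (ℝ × ℝ × ℝ) :=
  {p | 0 ≤ p.1 ∧ p.1 ≤ p.2.1 ∧ p.2.1 ≤ p.2.2 ∧ p.2.2 ≤ T}

theorem almostEq_iff_dual {U : Type*} [AddCommGroup U] [Module ℝ U] {ρ T : ℝ} {ω : ℝ → ℝ → ℝ}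
    (hω : IsControl T ω) {m : ℕ} {A B : ℝ → ℝ → U} :
    AlmostEq ρ T ω m A B ↔ ∀ φ : Module.Dual ℝ U,
      (fun p : ℝ × ℝ => φ (A p.1 p.2 - B p.1 p.2)) =O[𝓟 (simplex T)]
        fun p => ω p.1 p.2 ^ ((m : ℝ) / ρ) := by
  refine forall_congr' fun φ => ?_
  rw [isBigO_principal]
  refine exists_congr fun C => ⟨fun h p hp => ?_, fun h s t hs hst ht => ?_⟩
  · rw [Real.norm_of_nonneg (Real.rpow_nonneg (hω.nonneg _ _ hp.1 hp.2.1 hp.2.2) _)]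
    exact h p.1 p.2 hp.1 hp.2.1 hp.2.2
  · have := h (s, t) ⟨hs, hst, ht⟩
    rwa [Real.norm_of_nonneg (Real.rpow_nonneg (hω.nonneg _ _ hs hst ht) _)] at this

theorem almostEq_iff {W : Type*} [NormedAddCommGroup W] [NormedSpace ℝ W] [FiniteDimensional ℝ W]
    {ρ T : ℝ} {ω : ℝ → ℝ → ℝ} (hω : IsControl T ω) {m : ℕ} {A B : ℝ → ℝ → W} :
    AlmostEq ρ T ω m A B ↔ (fun p : ℝ × ℝ => A p.1 p.2 - B p.1 p.2) =O[𝓟 (simplex T)]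
        fun p => ω p.1 p.2 ^ ((m : ℝ) / ρ) := by
  rw [almostEq_iff_dual hω]
  exact ⟨isBigO_of_forall_dual, fun h φ => (φ.toContinuousLinearMap.isBigO_comp _ _).trans h⟩

/-! ### The germ of the rough integral. -/

section RoughPath

variable {ι : Type*} {ρ T : ℝ} {ω : ℝ → ℝ → ℝ} {X : ℝ → ℝ → HGL ι ⌊ρ⌋₊}

theorem IsBranchedRoughPath.isBigO (hX : IsBranchedRoughPath ρ T ω X) (hω : IsControl T ω)
    (f : Forest ι) :
    (fun p : ℝ × ℝ => (X p.1 p.2 : CKDual ι) (of f)) =O[𝓟 (simplex T)]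
      fun p => ω p.1 p.2 ^ ((f.weight : ℝ) / ρ) := by
  rcases le_or_gt f.weight ⌊ρ⌋₊ with h | h
  · obtain ⟨C, hC⟩ := hX.regular f h
    refine isBigO_principal.2 ⟨C, fun p hp => ?_⟩
    rw [Real.norm_of_nonneg (Real.rpow_nonneg (hω.nonneg _ _ hp.1 hp.2.1 hp.2.2) _)]
    exact hC p.1 p.2 hp.1 hp.2.1 hp.2.2
  · have : (fun p : ℝ × ℝ => (X p.1 p.2 : CKDual ι) (of f)) = fun _ => 0 :=
      funext fun p => (X p.1 p.2).2 f h
    rw [this]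
    exact isBigO_zero _ _

variable {W : Type*} [NormedAddCommGroup W] [NormedSpace ℝ W] [FiniteDimensional ℝ W]
  {H : ℝ → HGL ι (⌊ρ⌋₊ - 1) →ₗ[ℝ] Q ι ⌊ρ⌋₊ →ₗ[ℝ] W}

/-- Compare `H t` with `H 0`: the increment is bounded by a multiple of `ω 0 T ^ (1 / ρ)`. -/
theorem IsControlledPath.isBigO_one (hH : IsControlledPath ρ T ω X H) (hω : IsControl T ω)
    (hρ : 0 < ρ) {P : Type*} {S : Set P} {t : P → ℝ} (ht : ∀ p ∈ S, 0 ≤ t p ∧ t p ≤ T)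
    (h : HGL ι (⌊ρ⌋₊ - 1)) (q : Q ι ⌊ρ⌋₊) :
    (fun p => H (t p) h q) =O[𝓟 S] fun _ => (1 : ℝ) := by
  refine isBigO_of_forall_dual fun φ => ?_
  obtain ⟨C, hC⟩ := hH.regular (φ ∘ₗ LinearMap.applyₗ q ∘ₗ LinearMap.applyₗ h)
  refine isBigO_principal.2 ⟨|C| * ω 0 T ^ (((1 : ℕ) : ℝ) / ρ) + |φ (H 0 h q)|, fun p hp => ?_⟩
  obtain ⟨h0, h1⟩ := ht p hp
  have := hC 0 (t p) le_rfl h0 h1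
  simp only [LinearMap.comp_apply, LinearMap.applyₗ_apply_apply, map_sub] at this
  have hw : ω 0 (t p) ^ (((1 : ℕ) : ℝ) / ρ) ≤ ω 0 T ^ (((1 : ℕ) : ℝ) / ρ) :=
    Real.rpow_le_rpow (hω.nonneg _ _ le_rfl h0 h1) (hω.mono le_rfl le_rfl h0 h1 le_rfl)
      (by positivity)
  have hw0 : 0 ≤ ω 0 (t p) ^ (((1 : ℕ) : ℝ) / ρ) :=
    Real.rpow_nonneg (hω.nonneg _ _ le_rfl h0 h1) _
  have h2 : C * ω 0 (t p) ^ (((1 : ℕ) : ℝ) / ρ) ≤ |C| * ω 0 T ^ (((1 : ℕ) : ℝ) / ρ) :=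
    mul_le_mul (le_abs_self C) hw hw0 (abs_nonneg C)
  rw [norm_one, mul_one, Real.norm_eq_abs]
  have h3 := abs_add_le (φ (H (t p) h q) - φ (H 0 h q)) (φ (H 0 h q))
  rw [sub_add_cancel] at h3
  linarith

theorem IsControlledPath.isBigO_sub (hH : IsControlledPath ρ T ω X H) (hω : IsControl T ω)
    {g : Forest ι} (hg : g.weight < ⌊ρ⌋₊) (q : Q ι ⌊ρ⌋₊) :
    (fun p : ℝ × ℝ => (H p.2 (trunc (⌊ρ⌋₊ - 1) (coord g))
        - H p.1 (trunc (⌊ρ⌋₊ - 1) (glMul (X p.1 p.2) (coord g)))) q) =O[𝓟 (simplex T)]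
      fun p => ω p.1 p.2 ^ (((⌊ρ⌋₊ - g.weight : ℕ) : ℝ) / ρ) := by
  have hmem : coord g ∈ HGLHom ι g.weight := fun f hf => coord_of_ne (by rintro rfl; exact hf rfl)
  have hcoe : (trunc (⌊ρ⌋₊ - 1) (coord g) : CKDual ι) = coord g :=
    coe_trunc_eq_self (HGL_mono (by omega) (HGLHom_le _ hmem))
  have := hH.controlled g.weight hg (trunc (⌊ρ⌋₊ - 1) (coord g)) (by rwa [hcoe])
  rw [almostEq_iff_dual hω, hcoe] at this
  exact isBigO_of_forall_dual fun φ => this (φ ∘ₗ LinearMap.applyₗ q)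

theorem isBigO_topPairing [Finite ι] (hω : IsControl T ω) (hρ : 1 ≤ ρ)
    (hX : IsBranchedRoughPath ρ T ω X) (hH : IsControlledPath ρ T ω X H) :
    (fun p : ℝ × ℝ => topPairing (H p.1) (X p.1 p.2)) =O[𝓟 (simplex T)]
      fun p => ω p.1 p.2 ^ (((1 : ℕ) : ℝ) / ρ) := by
  simp only [topPairing_eq]
  refine isBigO_topFull (fun h q => hH.isBigO_one hω (by linarith)
      (fun p hp => ⟨hp.1, hp.2.1.trans hp.2.2⟩) h q) fun f k =>
    isBigO_apply_top (m := 0) (fun g hg => ?_) (Nat.zero_le _)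
  exact (hX.isBigO hω g).trans (isBigO_rpow_of_le (M := ω 0 T) (by linarith)
    (fun p hp => hω.nonneg _ _ hp.1 hp.2.1 hp.2.2)
    (fun p hp => hω.mono le_rfl hp.1 hp.2.1 hp.2.2 le_rfl) hg)

/-- The germ of the rough integral is almost additive. -/
theorem isBigO_topPairing_defect [Finite ι] (hω : IsControl T ω) (hρ : 1 ≤ ρ)
    (hX : IsBranchedRoughPath ρ T ω X) (hH : IsControlledPath ρ T ω X H) :
    (fun p : ℝ × ℝ × ℝ => topPairing (H p.1) (X p.1 p.2.2) - topPairing (H p.1) (X p.1 p.2.1)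
        - topPairing (H p.2.1) (X p.2.1 p.2.2)) =O[𝓟 (simplex₃ T)]
      fun p => ω p.1 p.2.2 ^ (((⌊ρ⌋₊ + 1 : ℕ) : ℝ) / ρ) := by
  have hρ0 : 0 < ρ := by linarith
  have hN : 1 ≤ ⌊ρ⌋₊ := Nat.le_floor (by exact_mod_cast hρ)
  have h0 : ∀ p ∈ simplex₃ T, 0 ≤ ω p.1 p.2.2 := fun p hp =>
    hω.nonneg _ _ hp.1 (hp.2.1.trans hp.2.2.1) hp.2.2.2
  have hM : ∀ p ∈ simplex₃ T, ω p.1 p.2.2 ≤ ω 0 T := fun p hp =>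
    hω.mono le_rfl hp.1 (hp.2.1.trans hp.2.2.1) hp.2.2.2 le_rfl
  have t₁ : Tendsto (fun p : ℝ × ℝ × ℝ => (p.1, p.2.1)) (𝓟 (simplex₃ T)) (𝓟 (simplex T)) :=
    tendsto_principal_principal.2 fun p hp => ⟨hp.1, hp.2.1, hp.2.2.1.trans hp.2.2.2⟩
  have t₂ : Tendsto (fun p : ℝ × ℝ × ℝ => (p.2.1, p.2.2)) (𝓟 (simplex₃ T)) (𝓟 (simplex T)) :=
    tendsto_principal_principal.2 fun p hp => ⟨hp.1.trans hp.2.1, hp.2.2.1, hp.2.2.2⟩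
  have m₁ : ∀ m : ℕ, (fun p : ℝ × ℝ × ℝ => ω p.1 p.2.1 ^ ((m : ℝ) / ρ)) =O[𝓟 (simplex₃ T)]
      fun p => ω p.1 p.2.2 ^ ((m : ℝ) / ρ) := isBigO_rpow_mono hρ0
    (fun p hp => hω.nonneg _ _ hp.1 hp.2.1 (hp.2.2.1.trans hp.2.2.2))
    (fun p hp => hω.mono hp.1 le_rfl hp.2.1 hp.2.2.1 hp.2.2.2)
  have m₂ : ∀ m : ℕ, (fun p : ℝ × ℝ × ℝ => ω p.2.1 p.2.2 ^ ((m : ℝ) / ρ)) =O[𝓟 (simplex₃ T)]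
      fun p => ω p.1 p.2.2 ^ ((m : ℝ) / ρ) := isBigO_rpow_mono hρ0
    (fun p hp => hω.nonneg _ _ (hp.1.trans hp.2.1) hp.2.2.1 hp.2.2.2)
    (fun p hp => hω.mono hp.1 hp.2.1 hp.2.2.1 le_rfl hp.2.2.2)
  have x₁ := fun f : Forest ι => ((hX.isBigO hω f).comp_tendsto t₁).trans (m₁ _)
  have x₂ := fun f : Forest ι => ((hX.isBigO hω f).comp_tendsto t₂).trans (m₂ _)
  -- What the truncation in Chen's relation discards lives on forests of weight at least `⌊ρ⌋₊ + 1`.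
  have hrest : (fun p : ℝ × ℝ × ℝ => topFull (H p.1)
      (glMul (ι := ι) (X p.1 p.2.1) (X p.2.1 p.2.2)
        - (trunc ⌊ρ⌋₊ (glMul (ι := ι) (X p.1 p.2.1) (X p.2.1 p.2.2)) : CKDual ι))) =O[𝓟 (simplex₃ T)]
      fun p => ω p.1 p.2.2 ^ (((⌊ρ⌋₊ + 1 : ℕ) : ℝ) / ρ) := by
    refine isBigO_topFull_sub_trunc (fun h q => hH.isBigO_one hω hρ0
      (fun p hp => ⟨hp.1, hp.2.1.trans (hp.2.2.1.trans hp.2.2.2)⟩) h q) fun f hf => ?_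
    refine isBigO_glMul fun g k hgk => ((x₁ g).mul (x₂ k)).trans
      ((isBigO_rpow_mul hρ0 h0 _ _).trans (isBigO_rpow_of_le hρ0 h0 hM ?_))
    omega
  -- The orders `⌊ρ⌋₊ - |g|` (controlledness) and `|g| + 1` (grafting) add up to `⌊ρ⌋₊ + 1` in every
  -- summand.
  have hsum : (fun p : ℝ × ℝ × ℝ => ∑ g ∈ forestsLE ι (⌊ρ⌋₊ - 1),
      (H p.2.1 (trunc (⌊ρ⌋₊ - 1) (coord g))
        - H p.1 (trunc (⌊ρ⌋₊ - 1) (glMul (X p.1 p.2.1) (coord g))))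
          (topQ ⌊ρ⌋₊ g (X p.2.1 p.2.2 : CKDual ι))) =O[𝓟 (simplex₃ T)]
      fun p => ω p.1 p.2.2 ^ (((⌊ρ⌋₊ + 1 : ℕ) : ℝ) / ρ) := by
    refine IsBigO.fun_sum fun g hg => ?_
    have hg' : g.weight < ⌊ρ⌋₊ := by have := mem_forestsLE.1 hg; omega
    refine (isBigO_apply_topQ
      (fun q => ((hH.isBigO_sub hω hg' q).comp_tendsto t₁).trans (m₁ _))
      (fun k => isBigO_apply_top (m := g.weight) (fun f hf => (x₂ f).trans
        (isBigO_rpow_of_le hρ0 h0 hM (Nat.succ_le_of_lt hf))) le_rfl)).trans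
      ((isBigO_rpow_mul hρ0 h0 _ _).trans (isBigO_rpow_of_le hρ0 h0 hM ?_))
    omega
  refine (hrest.neg_left.sub hsum).congr' ?_ EventuallyEq.rfl
  refine eventually_principal.2 fun p hp => ?_
  have e1 : (X p.2.1 p.2.2 : CKDual ι) 1 = 1 :=
    hX.map_one _ _ (hp.1.trans hp.2.1) hp.2.2.1 hp.2.2.2
  have e2 := topFull_glMul (H p.1) (X p.1 p.2.1 : CKDual ι) (X p.2.1 p.2.2 : CKDual ι)
  rw [e1, one_smul] at e2
  simp only [topPairing_eq]
  rw [hX.chen p.1 p.2.1 p.2.2 hp.1 hp.2.1 hp.2.2.1 hp.2.2.2, map_sub, e2,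
    topFull_apply (H p.2.1)]
  simp only [LinearMap.sub_apply, Finset.sum_sub_distrib]
  abel

end RoughPath

theorem coe_glOne {ι : Type*} (M : ℕ) : (glOne ι M : CKDual ι) = coord 1 :=
  coe_trunc_eq_self fun f hf => coord_of_ne (by
    rintro rfl
    rw [weight_one] at hf
    omega)

/-! ### Existence and uniqueness of the integral path. -/

section IntegralPath

variable {ι : Type*} [Finite ι] {W : Type*} [AddCommGroup W] [Module ℝ W] {N : ℕ} {T : ℝ}

/-- The linear map `h ↦ ⟨1, h⟩ w + ⟨A, h⟩` on `H_GL^(N-1)`. -/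
def integralMap (A : HGL ι (N - 1) →ₗ[ℝ] Q ι N →ₗ[ℝ] W) (w : W) : HGL ι (N - 1) →ₗ[ℝ] W :=
  ((Module.Dual.eval ℝ (CK ι) 1) ∘ₗ (HGL ι (N - 1)).subtype).smulRight w
    + topFull A ∘ₗ (HGL ι (N - 1)).subtype

theorem integralMap_apply (A : HGL ι (N - 1) →ₗ[ℝ] Q ι N →ₗ[ℝ] W) (w : W) (h : HGL ι (N - 1)) :
    integralMap A w h = (h : CKDual ι) 1 • w + topFull A (h : CKDual ι) := rfl

/-- The two summands separate the two conditions: `topFull` vanishes at `1`, and `(h ⋆ q)(1) = h(1)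
q(1) = 0`. The bound on `m + n` ensures that `h ⋆ q` is not truncated. -/
theorem isIntegralPath_integralMap (H : ℝ → HGL ι (N - 1) →ₗ[ℝ] Q ι N →ₗ[ℝ] W) (I : ℝ → ℝ → W) :
    IsIntegralPath T H I fun t => integralMap (H t) (I 0 t) := by
  refine fun t _ _ => ⟨?_, fun m n h q hmn hh hq => ?_⟩
  · rw [integralMap_apply, coe_glOne, topFull_coord_one, add_zero, coord_one, counit_one, one_smul]
  · rw [integralMap_apply, coe_trunc_eq_self (HGL_mono hmn (glMul_mem hh hq)), topFull_glMul_Q,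
      glMul_one, Q_apply_one, mul_zero, zero_smul, zero_add]

theorem eq_smul_glOne_add_sum (h : HGL ι (N - 1)) :
    h = (h : CKDual ι) 1 • glOne ι (N - 1) + ∑ g ∈ forestsLE ι (N - 1),
      trunc (N - 1) (glMul (trunc (N - 1) (coord g) : CKDual ι) (topQ N g (h : CKDual ι))) := by
  refine Subtype.ext (lin_ext fun f => ?_)
  rw [Submodule.coe_add, AddSubmonoidClass.coe_finsetSum, LinearMap.add_apply, LinearMap.sum_apply,
    Submodule.coe_smul, LinearMap.smul_apply, coe_glOne, smul_eq_mul]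
  simp only [trunc_of]
  split_ifs with hf
  · rw [eq_sum_glMul_topQ (Nat.sub_le N 1) h.2 hf]
    congr 1
    refine Finset.sum_congr rfl fun g hg => ?_
    rw [coe_trunc_eq_self]
    exact fun k hk => coord_of_ne (by
      rintro rfl
      have := mem_forestsLE.1 hg
      omega)
  · rw [h.2 f (by omega), coord_of_ne (by rintro rfl; rw [weight_one] at hf; omega)]
    simp

theorem IsIntegralPath.unique {H : ℝ → HGL ι (N - 1) →ₗ[ℝ] Q ι N →ₗ[ℝ] W} {I : ℝ → ℝ → W}
    {Z Z' : ℝ → HGL ι (N - 1) →ₗ[ℝ] W} (hZ : IsIntegralPath T H I Z)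
    (hZ' : IsIntegralPath T H I Z') {t : ℝ} (h0 : 0 ≤ t) (hT : t ≤ T) : Z t = Z' t := by
  refine LinearMap.ext fun h => ?_
  obtain ⟨a, b⟩ := hZ t h0 hT
  obtain ⟨a', b'⟩ := hZ' t h0 hT
  rw [eq_smul_glOne_add_sum h, map_add, map_add, map_smul, map_smul, a, a', map_sum, map_sum]
  congr 1
  refine Finset.sum_congr rfl fun g hg => ?_
  have hg' := mem_forestsLE.1 hg
  have hmem : (trunc (N - 1) (coord g) : CKDual ι) ∈ HGL ι g.weight := fun k hk => by
    rw [trunc_of, coord_of_ne (by rintro rfl; omega), ite_self]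
  -- In the decomposition of `h` the factors have weights at most `|g|` and `N - 1 - |g|`, so every
  -- product is one at which `Z` is prescribed.
  have hq := topQ_mem (Nat.sub_le N 1) g h.2
  rw [b g.weight _ _ _ (by omega) hmem hq, b' g.weight _ _ _ (by omega) hmem hq]

end IntegralPath

/-! ### The integral path is controlled. -/

section Controlled

variable {ι : Type*} [Finite ι] {ρ T : ℝ} {ω : ℝ → ℝ → ℝ} {X : ℝ → ℝ → HGL ι ⌊ρ⌋₊}
  {W : Type*} [NormedAddCommGroup W] [NormedSpace ℝ W] [FiniteDimensional ℝ W]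
  {H : ℝ → HGL ι (⌊ρ⌋₊ - 1) →ₗ[ℝ] Q ι ⌊ρ⌋₊ →ₗ[ℝ] W} {I : ℝ → ℝ → W}

/-- `topFull`, as a linear map in its first argument. -/
def topFullLin (ι : Type*) [Finite ι] (N : ℕ) (W : Type*) [AddCommGroup W] [Module ℝ W] :
    (HGL ι (N - 1) →ₗ[ℝ] Q ι N →ₗ[ℝ] W) →ₗ[ℝ] HGL ι (N - 1) →ₗ[ℝ] W where
  toFun A := topFull A ∘ₗ (HGL ι (N - 1)).subtype
  map_add' A B := LinearMap.ext fun h => by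
    simp [topFull_apply, Finset.sum_add_distrib]
  map_smul' c A := LinearMap.ext fun h => by
    simp [topFull_apply, Finset.smul_sum]

theorem integralMap_regular (hω : IsControl T ω) (hρ : 1 ≤ ρ)
    (hX : IsBranchedRoughPath ρ T ω X) (hH : IsControlledPath ρ T ω X H) (hI : IsAdditive T I)
    (hIX : AlmostEq ρ T ω (⌊ρ⌋₊ + 1) I fun s t => topPairing (H s) (X s t)) :
    AlmostEq ρ T ω 1 (fun _ t => integralMap (H t) (I 0 t)) fun s _ => integralMap (H s) (I 0 s) := by
  have hρ0 : 0 < ρ := by linarith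
  rw [almostEq_iff_dual hω]
  intro φ
  -- `Z_t - Z_s` is `e (I s t)` plus the image of `H t - H s` under `topFullLin`, so a functional on
  -- its values pulls back to one on `W` and one on the values of `H`.
  let e : W →ₗ[ℝ] HGL ι (⌊ρ⌋₊ - 1) →ₗ[ℝ] W :=
    LinearMap.smulRightₗ ((Module.Dual.eval ℝ (CK ι) 1) ∘ₗ (HGL ι (⌊ρ⌋₊ - 1)).subtype)
  have h1 := (almostEq_iff hω).1 hIX
  have h2 := (h1.trans (isBigO_rpow_of_le (M := ω 0 T) hρ0
    (fun p hp => hω.nonneg _ _ hp.1 hp.2.1 hp.2.2)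
    (fun p hp => hω.mono le_rfl hp.1 hp.2.1 hp.2.2 le_rfl)
      (show 1 ≤ ⌊ρ⌋₊ + 1 by omega))).add (isBigO_topPairing hω hρ hX hH)
  simp only [sub_add_cancel] at h2
  have h3 := ((φ ∘ₗ e).toContinuousLinearMap.isBigO_comp _ _).trans h2
  have h4 := (almostEq_iff_dual hω).1 hH.regular (φ ∘ₗ topFullLin ι ⌊ρ⌋₊ W)
  refine (h3.add h4).congr' (eventually_principal.2 fun p hp => ?_) EventuallyEq.rfl
  change φ (e (I p.1 p.2)) + φ (topFullLin ι ⌊ρ⌋₊ W (H p.2 - H p.1)) = φ _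
  rw [← map_add]
  congr 1
  rw [← hI 0 p.1 p.2 le_rfl hp.1 hp.2.1 hp.2.2, map_sub]
  refine LinearMap.ext fun h => ?_
  simp only [LinearMap.add_apply, LinearMap.sub_apply, integralMap_apply, smul_add]
  change (h : CKDual ι) 1 • I p.1 p.2 + (topFull (H p.2) (h : CKDual ι)
    - topFull (H p.1) (h : CKDual ι)) = _
  abel

/-- By `topFull_glMul` with `y = h`, the remainder is the sum of three terms: `h(1)` times the
sewing error, the controlledness errors of `H` paired with the components of `h`, and the truncated
part of `X ⋆ h`. Each is of order `⌊ρ⌋₊ - n`. -/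
theorem integralMap_controlled (hω : IsControl T ω) (hρ : 1 ≤ ρ)
    (hX : IsBranchedRoughPath ρ T ω X) (hH : IsControlledPath ρ T ω X H) (hI : IsAdditive T I)
    (hIX : AlmostEq ρ T ω (⌊ρ⌋₊ + 1) I fun s t => topPairing (H s) (X s t)) {n : ℕ}
    (hn : n < ⌊ρ⌋₊) (h : HGL ι (⌊ρ⌋₊ - 1)) (hh : (h : CKDual ι) ∈ HGLHom ι n) :
    AlmostEq ρ T ω (⌊ρ⌋₊ - n) (fun _ t => integralMap (H t) (I 0 t) h)
      fun s t => integralMap (H s) (I 0 s) (trunc (⌊ρ⌋₊ - 1) (glMul (X s t) h)) := by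
  have hρ0 : 0 < ρ := by linarith
  have h0 : ∀ p ∈ simplex T, 0 ≤ ω p.1 p.2 := fun p hp => hω.nonneg _ _ hp.1 hp.2.1 hp.2.2
  have hM : ∀ p ∈ simplex T, ω p.1 p.2 ≤ ω 0 T := fun p hp =>
    hω.mono le_rfl hp.1 hp.2.1 hp.2.2 le_rfl
  rw [almostEq_iff hω]
  have a₁ : (fun p : ℝ × ℝ => (h : CKDual ι) 1 • (I p.1 p.2 - topPairing (H p.1) (X p.1 p.2)))
      =O[𝓟 (simplex T)] fun p => ω p.1 p.2 ^ (((⌊ρ⌋₊ - n : ℕ) : ℝ) / ρ) :=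
    (((almostEq_iff hω).1 hIX).trans (isBigO_rpow_of_le hρ0 h0 hM (by omega))).const_smul_left _
  have a₂ : (fun p : ℝ × ℝ => ∑ g ∈ forestsLE ι (⌊ρ⌋₊ - 1),
      (H p.2 (trunc (⌊ρ⌋₊ - 1) (coord g))
        - H p.1 (trunc (⌊ρ⌋₊ - 1) (glMul (X p.1 p.2) (coord g)))) (topQ ⌊ρ⌋₊ g (h : CKDual ι)))
      =O[𝓟 (simplex T)] fun p => ω p.1 p.2 ^ (((⌊ρ⌋₊ - n : ℕ) : ℝ) / ρ) := by
    refine IsBigO.fun_sum fun g hg => ?_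
    have hg' : g.weight < ⌊ρ⌋₊ := by have := mem_forestsLE.1 hg; omega
    rcases le_or_gt g.weight n with hgn | hgn
    · exact (hH.isBigO_sub hω hg' _).trans (isBigO_rpow_of_le hρ0 h0 hM (by omega))
    -- For `|g| > n` the order `⌊ρ⌋₊ - |g|` would be too small, but `h` of weight `n` cannot see `g
    -- ⊤ k`.
    · have : topQ ⌊ρ⌋₊ g (h : CKDual ι) = 0 := by
        rw [topQ_eq_sum]
        refine Finset.sum_eq_zero fun k _ => ?_
        rw [HGL_apply_homC (HGLHom_le n hh) (top_of_mem_homC g k) (by omega), zero_smul]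
      simp only [this, map_zero]
      exact isBigO_zero _ _
  have a₃ : (fun p : ℝ × ℝ => topFull (H p.1) (glMul (X p.1 p.2 : CKDual ι) (h : CKDual ι)
      - (trunc (⌊ρ⌋₊ - 1) (glMul (X p.1 p.2 : CKDual ι) (h : CKDual ι)) : CKDual ι)))
      =O[𝓟 (simplex T)] fun p => ω p.1 p.2 ^ (((⌊ρ⌋₊ - n : ℕ) : ℝ) / ρ) := by
    refine isBigO_topFull_sub_trunc (fun h q => hH.isBigO_one hω hρ0
      (fun p hp => ⟨hp.1, hp.2.1.trans hp.2.2⟩) h q) fun f hf => ?_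
    refine isBigO_glMul fun g k hgk => ?_
    -- Since `h` is homogeneous, only `|k| = n` counts, and then `|g| ≥ ⌊ρ⌋₊ - n` because the
    -- discarded forests have weight at least `⌊ρ⌋₊`.
    by_cases hk : k.weight = n
    · simpa only [mul_comm] using ((hX.isBigO hω g).trans
        (isBigO_rpow_of_le hρ0 h0 hM (by omega))).const_mul_left ((h : CKDual ι) (of k))
    · simp only [hh k hk, mul_zero]
      exact isBigO_zero _ _
  refine ((a₁.add a₂).add a₃).congr' (eventually_principal.2 fun p hp => ?_) EventuallyEq.rfl
  have e1 : (X p.1 p.2 : CKDual ι) 1 = 1 := hX.map_one _ _ hp.1 hp.2.1 hp.2.2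
  have e2 : (trunc (⌊ρ⌋₊ - 1) (glMul (X p.1 p.2 : CKDual ι) (h : CKDual ι)) : CKDual ι) 1
      = (h : CKDual ι) 1 := by
    rw [← of_one, trunc_of, if_pos (by rw [weight_one]; exact Nat.zero_le _), of_one, glMul_one, e1,
      one_mul]
  simp only [integralMap_apply, e2]
  rw [map_sub, topFull_glMul, ← hI 0 p.1 p.2 le_rfl hp.1 hp.2.1 hp.2.2, topPairing_eq,
    topFull_apply (H p.2), smul_sub, smul_add]
  simp only [LinearMap.sub_apply, Finset.sum_sub_distrib]
  abel

end Controlled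

end BranchedRP

end

/-! ### The proposition. -/

theorem mainTheorem3 {ι : Type*} [Finite ι] {W : Type*} [NormedAddCommGroup W] [NormedSpace ℝ W]
    [FiniteDimensional ℝ W] (ρ T : ℝ) (hρ : 1 ≤ ρ) (hT : 0 ≤ T)
    (ω : ℝ → ℝ → ℝ) (hω : BranchedRP.IsControl T ω)
    (X : ℝ → ℝ → BranchedRP.HGL ι ⌊ρ⌋₊) (hX : BranchedRP.IsBranchedRoughPath ρ T ω X)
    (H : ℝ → BranchedRP.HGL ι (⌊ρ⌋₊ - 1) →ₗ[ℝ] BranchedRP.Q ι ⌊ρ⌋₊ →ₗ[ℝ] W)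
    (hH : BranchedRP.IsControlledPath ρ T ω X H) :
    (∃ C : ℝ, ∀ s u t, 0 ≤ s → s ≤ u → u ≤ t → t ≤ T →
      ‖BranchedRP.topPairing (H s) (X s t) - BranchedRP.topPairing (H s) (X s u)
          - BranchedRP.topPairing (H u) (X u t)‖
        ≤ C * ω s t ^ (((⌊ρ⌋₊ + 1 : ℕ) : ℝ) / ρ)) ∧
    ∃ I : ℝ → ℝ → W,
      (∀ s t, 0 ≤ s → s ≤ t → t ≤ T →
        BranchedRP.RiemannSumsTendsto (fun u v => BranchedRP.topPairing (H u) (X u v)) s t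
          (I s t)) ∧
      BranchedRP.IsAdditive T I ∧
      BranchedRP.AlmostEq ρ T ω (⌊ρ⌋₊ + 1) I
        (fun s t => BranchedRP.topPairing (H s) (X s t)) ∧
      (∀ J : ℝ → ℝ → W, BranchedRP.IsAdditive T J →
        BranchedRP.AlmostEq ρ T ω (⌊ρ⌋₊ + 1) J
          (fun s t => BranchedRP.topPairing (H s) (X s t)) →
        ∀ s t, 0 ≤ s → s ≤ t → t ≤ T → J s t = I s t) ∧
      ∃ Z : ℝ → BranchedRP.HGL ι (⌊ρ⌋₊ - 1) →ₗ[ℝ] W,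
        BranchedRP.IsIntegralPath T H I Z ∧
        BranchedRP.IsControlledPath ρ T ω X Z ∧
        ∀ Z' : ℝ → BranchedRP.HGL ι (⌊ρ⌋₊ - 1) →ₗ[ℝ] W, BranchedRP.IsIntegralPath T H I Z' →
          ∀ t, 0 ≤ t → t ≤ T → Z' t = Z t := by
  have hρ0 : 0 < ρ := by linarith
  have hθ : 1 < ((⌊ρ⌋₊ + 1 : ℕ) : ℝ) / ρ := by
    rw [one_lt_div hρ0]
    exact_mod_cast Nat.lt_floor_add_one ρ
  obtain ⟨C, hC⟩ := Asymptotics.isBigO_principal.1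
    (BranchedRP.isBigO_topPairing_defect hω hρ hX hH)
  have hr : ∀ s t, 0 ≤ s → s ≤ t → t ≤ T →
      0 ≤ ω s t ^ (((⌊ρ⌋₊ + 1 : ℕ) : ℝ) / ρ) := fun s t hs hst ht =>
    Real.rpow_nonneg (hω.nonneg s t hs hst ht) _
  have hadd : BranchedRP.AlmostAdditive T (((⌊ρ⌋₊ + 1 : ℕ) : ℝ) / ρ) |C| ω
      fun s t => BranchedRP.topPairing (H s) (X s t) := fun s u t hs hsu hut ht => by
    have := hC (s, u, t) ⟨hs, hsu, hut, ht⟩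
    rw [Real.norm_of_nonneg (hr s t hs (hsu.trans hut) ht)] at this
    exact this.trans (mul_le_mul_of_nonneg_right (le_abs_self C) (hr s t hs (hsu.trans hut) ht))
  have : ProperSpace W := FiniteDimensional.proper ℝ W
  obtain ⟨I, hI, hIX⟩ := hadd.exists_isAdditive hω hθ (abs_nonneg C)
  generalize 2 * |C| / (1 - 2 ^ (1 - ((⌊ρ⌋₊ + 1 : ℕ) : ℝ) / ρ)) = K at hIX
  have hriem : ∀ (L : ℝ) (J : ℝ → ℝ → W), BranchedRP.IsAdditive T J →
      (∀ s t, 0 ≤ s → s ≤ t → t ≤ T → ‖J s t - BranchedRP.topPairing (H s) (X s t)‖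
        ≤ L * ω s t ^ (((⌊ρ⌋₊ + 1 : ℕ) : ℝ) / ρ)) →
      ∀ s t, 0 ≤ s → s ≤ t → t ≤ T → BranchedRP.RiemannSumsTendsto
        (fun u v => BranchedRP.topPairing (H u) (X u v)) s t (J s t) :=
    fun L J hJ hJX s t hs hst ht => hJ.riemannSumsTendsto hω hθ hJX hs hst ht
  have hIA : BranchedRP.AlmostEq ρ T ω (⌊ρ⌋₊ + 1) I
      fun s t => BranchedRP.topPairing (H s) (X s t) := by
    refine (BranchedRP.almostEq_iff hω).2 (Asymptotics.isBigO_principal.2 ⟨K, fun p hp => ?_⟩)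
    rw [Real.norm_of_nonneg (hr p.1 p.2 hp.1 hp.2.1 hp.2.2)]
    exact hIX p.1 p.2 hp.1 hp.2.1 hp.2.2
  refine ⟨⟨|C|, hadd⟩, I, hriem K I hI hIX, hI, hIA, fun J hJ hJA s t hs hst ht => ?_, ?_⟩
  · obtain ⟨L, hL⟩ := Asymptotics.isBigO_principal.1 ((BranchedRP.almostEq_iff hω).1 hJA)
    -- Any competitor `J` is also the limit of the Riemann sums, so it agrees with `I`.
    refine (hriem L J hJ (fun s t hs hst ht => ?_) s t hs hst ht).unique hs hst ht
      (hriem K I hI hIX s t hs hst ht)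
    have := hL (s, t) ⟨hs, hst, ht⟩
    rwa [Real.norm_of_nonneg (hr s t hs hst ht)] at this
  · refine ⟨fun t => BranchedRP.integralMap (H t) (I 0 t),
      BranchedRP.isIntegralPath_integralMap H I,
      ⟨BranchedRP.integralMap_regular hω hρ hX hH hI hIA,
        fun n hn h hh => BranchedRP.integralMap_controlled hω hρ hX hH hI hIA hn h hh⟩,
      fun Z' hZ' t h0 hT => hZ'.unique (BranchedRP.isIntegralPath_integralMap H I) h0 hT⟩
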